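/- For $k\in\{1,2\}$ write $|0\pm k\rangle=\tfrac{1}{\sqrt2}(|0\rangle\pm|k\rangle)\in\mathbb{C}^3$. Let $\mathcal B\subset(\mathbb{C}^3)^{\otimes4}$ be the set of the following $81$ product states, shared by four parties $A_1,A_2,A_3,A_4$ (the $k$-th tensor factor belongs to $A_k$): the $40$ states $$\begin{array}{l} |0\rangle|0\rangle|1\rangle|0\pm 1\rangle,\ |0\rangle|0\rangle|2\rangle|0\pm 2\rangle,\ |2\rangle|1\rangle|0\rangle|0\pm 1\rangle,\ |1\rangle|1\rangle|2\rangle|0\pm 1\rangle,\ |2\rangle|1\rangle|2\rangle|0\pm 2\rangle,\\ |0\rangle|1\rangle|0\pm 1\rangle|0\rangle,\ |0\rangle|2\rangle|0\pm 2\rangle|0\rangle,\ |1\rangle|0\rangle|0\pm 1\rangle|2\rangle,\ |1\rangle|2\rangle|0\pm 1\rangle|1\rangle,\ |1\rangle|2\rangle|0\pm 2\rangle|2\rangle,\\ |1\rangle|0\pm 1\rangle|0\rangle|0\rangle,\ |2\rangle|0\pm 2\rangle|0\rangle|0\rangle,\ |0\rangle|0\pm 1\rangle|2\rangle|1\rangle,\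 |2\rangle|0\pm 1\rangle|1\rangle|1\rangle,\ |2\rangle|0\pm 2\rangle|2\rangle|1\rangle,\\ |0\pm 1\rangle|0\rangle|0\rangle|1\rangle,\ |0\pm 2\rangle|0\rangle|0\rangle|2\rangle,\ |0\pm 1\rangle|2\rangle|1\rangle|0\rangle,\ |0\pm 1\rangle|1\rangle|1\rangle|2\rangle,\ |0\pm 2\rangle|2\rangle|1\rangle|2\rangle \end{array}$$ and the $41$ computational product states $|x_1\rangle|x_2\rangle|x_3\rangle|x_4\rangle$ with $$\begin{array}{l}x_1x_2x_3x_4\in\{0000,\ 0012,\ 0101,\ 0102,\ 0111,\ 0120,\ 0122,\ 0201,\ 0202,\ 0211,\ 0221,\ 0222,\ 1010,\ 1011,\\ 1020,\ 1021,\ 1022,\ 1101,\ 1102,\ 1110,\ 1111,\ 1122,\ 1200,\ 1212,\ 1220,\ 1221,\ 2001,\ 2010,\\ 2012,\ 2020,\ 2022,\ 2102,\ 2110,\ 2112,\ 2121,\ 2201,\ 2202,\ 2210,\ 2211,\ 2220,\ 2222\}.\end{array}$$ Then $\mathcal B$ is an orthonormal basis of $(\mathbb{C}^3)^{\otimes4}$.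 If any two of the four parties come together in a single location, where they may operate jointly, while the other two parties stand alone, then $\mathcal B$ still cannot be perfectly distinguished by local operations and classical communication (LOCC). Consequently, for every partition of the four parties into three nonempty groups (every tripartition), $\mathcal B$ cannot be perfectly distinguished by LOCC among the three groups. Here an LOCC protocol consists of successive rounds, in finite or infinite number; in each round one location performs a measurement (with finitely or countably many outcomes) on its own system, possibly enlarged by an ancilla, and announces the outcome, and everything done later may depend on all outcomes announced so far; perfect discrimination means that, for a single protocol, the probability of identifying the prepared state correctly equals $1$, or becomes arbitrarily close to $1$ after sufficiently many rounds, for every state in $\mathcal B$. -/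

import Mathlib

noncomputable section

/-- The single-qutrit states that occur in the basis: the computational states `|0⟩, |1⟩, |2⟩`
and `|0 ± 1⟩ = (|0⟩ ± |1⟩)/√2`, `|0 ± 2⟩ = (|0⟩ ± |2⟩)/√2`. -/
inductive LocalState where
  | k0 | k1 | k2
  | p1 | m1
  | p2 | m2

/-- The coordinates of a single-qutrit state in the computational basis of `ℂ³`. -/
def LocalState.vec : LocalState → Fin 3 → ℂ
  | .k0 => ![1, 0, 0]
  | .k1 => ![0, 1, 0]
  | .k2 => ![0, 0, 1]
  | .p1 => ![((√2)⁻¹ : ℝ), ((√2)⁻¹ : ℝ), 0]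
  | .m1 => ![((√2)⁻¹ : ℝ), -((√2)⁻¹ : ℝ), 0]
  | .p2 => ![((√2)⁻¹ : ℝ), 0, ((√2)⁻¹ : ℝ)]
  | .m2 => ![((√2)⁻¹ : ℝ), 0, -((√2)⁻¹ : ℝ)]

/-- The four tensor factors of each of the 81 product states: first the 20 pairs of twisted
states, then the 41 computational product states. -/
def factors : Fin 81 → Fin 4 → LocalState :=
  ![
    ![.k0, .k0, .k1, .p1], ![.k0, .k0, .k1, .m1],
    ![.k0, .k0, .k2, .p2], ![.k0, .k0, .k2, .m2],
    ![.k2, .k1, .k0, .p1], ![.k2, .k1, .k0, .m1],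
    ![.k1, .k1, .k2, .p1], ![.k1, .k1, .k2, .m1],
    ![.k2, .k1, .k2, .p2], ![.k2, .k1, .k2, .m2],
    ![.k0, .k1, .p1, .k0], ![.k0, .k1, .m1, .k0],
    ![.k0, .k2, .p2, .k0], ![.k0, .k2, .m2, .k0],
    ![.k1, .k0, .p1, .k2], ![.k1, .k0, .m1, .k2],
    ![.k1, .k2, .p1, .k1], ![.k1, .k2, .m1, .k1],
    ![.k1, .k2, .p2, .k2], ![.k1, .k2, .m2, .k2],
    ![.k1, .p1, .k0, .k0], ![.k1, .m1, .k0, .k0],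
    ![.k2, .p2, .k0, .k0], ![.k2, .m2, .k0, .k0],
    ![.k0, .p1, .k2, .k1], ![.k0, .m1, .k2, .k1],
    ![.k2, .p1, .k1, .k1], ![.k2, .m1, .k1, .k1],
    ![.k2, .p2, .k2, .k1], ![.k2, .m2, .k2, .k1],
    ![.p1, .k0, .k0, .k1], ![.m1, .k0, .k0, .k1],
    ![.p2, .k0, .k0, .k2], ![.m2, .k0, .k0, .k2],
    ![.p1, .k2, .k1, .k0], ![.m1, .k2, .k1, .k0],
    ![.p1, .k1, .k1, .k2], ![.m1, .k1, .k1, .k2],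
    ![.p2, .k2, .k1, .k2], ![.m2, .k2, .k1, .k2],
    ![.k0, .k0, .k0, .k0], ![.k0, .k0, .k1, .k2], ![.k0, .k1, .k0, .k1],
    ![.k0, .k1, .k0, .k2], ![.k0, .k1, .k1, .k1], ![.k0, .k1, .k2, .k0],
    ![.k0, .k1, .k2, .k2], ![.k0, .k2, .k0, .k1], ![.k0, .k2, .k0, .k2],
    ![.k0, .k2, .k1, .k1], ![.k0, .k2, .k2, .k1], ![.k0, .k2, .k2, .k2],
    ![.k1, .k0, .k1, .k0], ![.k1, .k0, .k1, .k1], ![.k1, .k0, .k2, .k0],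
    ![.k1, .k0, .k2, .k1], ![.k1, .k0, .k2, .k2], ![.k1, .k1, .k0, .k1],
    ![.k1, .k1, .k0, .k2], ![.k1, .k1, .k1, .k0], ![.k1, .k1, .k1, .k1],
    ![.k1, .k1, .k2, .k2], ![.k1, .k2, .k0, .k0], ![.k1, .k2, .k1, .k2],
    ![.k1, .k2, .k2, .k0], ![.k1, .k2, .k2, .k1], ![.k2, .k0, .k0, .k1],
    ![.k2, .k0, .k1, .k0], ![.k2, .k0, .k1, .k2], ![.k2, .k0, .k2, .k0],
    ![.k2, .k0, .k2, .k2], ![.k2, .k1, .k0, .k2], ![.k2, .k1, .k1, .k0],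
    ![.k2, .k1, .k1, .k2], ![.k2, .k1, .k2, .k1], ![.k2, .k2, .k0, .k1],
    ![.k2, .k2, .k0, .k2], ![.k2, .k2, .k1, .k0], ![.k2, .k2, .k1, .k1],
    ![.k2, .k2, .k2, .k0], ![.k2, .k2, .k2, .k2]
  ]

/-- The 81 product states `|α₁⟩|α₂⟩|α₃⟩|α₄⟩` as unit vectors of `(ℂ³)^{⊗4}`, which is coordinatised
by the computational product basis: the index `x : Fin 4 → Fin 3` stands for `|x₁ x₂ x₃ x₄⟩`. -/
def basisState (i : Fin 81) : EuclideanSpace ℂ (Fin 4 → Fin 3) :=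
  WithLp.toLp 2 fun x => ∏ k, (factors i k).vec (x k)

section LOCC

/-- When the elementary `d`-level systems `s : S` are distributed among the locations (parties)
`p : P` by `π : S → P`, the party `p` holds the tensor product of all systems `s` with `π s = p`.
This is the index set of the computational product basis of that joint system. -/
abbrev LocalIndex {S P : Type} (d : ℕ) (π : S → P) (p : P) : Type := {s : S // π s = p} → Fin d

variable {S P : Type} [Fintype S] [DecidableEq S] [Fintype P] [DecidableEq P]

/-- An LOCC protocol, with finitely many rounds or not, for parties `p : P` who hold the systems
assigned to them by `π`. A list of natural numbers is a history of publicly announced measurement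
outcomes, the latest outcome first. In each round one party (which may depend on the history)
measures the system in its location and announces the outcome, after which the other parties may
apply isometries (e.g. unitaries, or the attachment of ancillas) depending on all that was
announced. Measurements are given by Kraus operators, and the dimensions of the local systems may
change. Measurements with finitely many outcomes are covered: the other Kraus operators are `0`. -/
structure LOCCProtocol (d : ℕ) (π : S → P) (ι : Type) where
  /-- the dimension of the local system of each party after a history -/
  dim : List ℕ → P → ℕ
  /-- isometries that are applied locally before the first round -/
  prep : ∀ p, Matrix (Fin (dim [] p)) (LocalIndex d π p) ℂ
  prep_isometry : ∀ p, (prep p).conjTranspose * prep p = 1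
  /-- the party that measures after a history -/
  actor : List ℕ → P
  /-- the operator that party `p` applies after history `h` if the next outcome is `o` -/
  op : ∀ (h : List ℕ) (o : ℕ) (p : P), Matrix (Fin (dim (o :: h) p)) (Fin (dim h p)) ℂ
  /-- the Kraus operators of the measuring party form a measurement -/
  complete : ∀ h, HasSum (fun o => (op h o (actor h)).conjTranspose * op h o (actor h)) 1
  /-- the other parties apply isometries -/
  op_isometry : ∀ h o p, p ≠ actor h → (op h o p).conjTranspose * op h o p = 1
  /-- the best guess of the prepared state, given a history -/
  guess : List ℕ → ι

namespace LOCCProtocol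

variable {d : ℕ} {π : S → P} {ι : Type}

/-- The operator that party `p` has applied in total along a history. -/
def localOp (T : LOCCProtocol d π ι) :
    ∀ (h : List ℕ) (p : P), Matrix (Fin (T.dim h p)) (LocalIndex d π p) ℂ
  | [], p => T.prep p
  | o :: h, p => T.op h o p * T.localOp h p

/-- The unnormalised state after a history: the tensor product over the parties of their local
operators, applied to the initial state `ψ`. -/
def output (T : LOCCProtocol d π ι) (h : List ℕ) (ψ : EuclideanSpace ℂ (S → Fin d)) :
    EuclideanSpace ℂ (∀ p, Fin (T.dim h p)) :=
  WithLp.toLp 2 fun y => ∑ x : S → Fin d, (∏ p, T.localOp h p (y p) fun s => x s) * ψ x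

open scoped ENNReal in
/-- The probability that the guess after `n` rounds is `i` if the unit vector `ψ` was prepared.
By the Born rule, a history `h` occurs with probability `‖T.output h ψ‖ ^ 2`. -/
def guessProb (T : LOCCProtocol d π ι) (n : ℕ) (ψ : EuclideanSpace ℂ (S → Fin d)) (i : ι) : ℝ≥0∞ :=
  ∑' h : {h : List ℕ // h.length = n ∧ T.guess h = i}, ‖T.output h ψ‖ₑ ^ 2

/-- The protocol identifies the states `ψ i` perfectly: after sufficiently many rounds, the
probability of a correct guess is as close to `1` as desired, whichever state was prepared. (For a
protocol that stops after `n` rounds this holds as soon as the probabilities after round `n` are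
equal to `1`.) -/
def Distinguishes (T : LOCCProtocol d π ι) (ψ : ι → EuclideanSpace ℂ (S → Fin d)) : Prop :=
  ∀ c < 1, ∃ n, ∀ i, c < T.guessProb n (ψ i) i

end LOCCProtocol

/-- The states `ψ i` can be perfectly distinguished by LOCC if the elementary systems are
distributed among the parties by `π`. -/
def LOCCDistinguishable {d : ℕ} {ι : Type} (π : S → P)
    (ψ : ι → EuclideanSpace ℂ (S → Fin d)) : Prop :=
  ∃ T : LOCCProtocol d π ι, T.Distinguishes ψ

end LOCC

/-- The distribution of the four systems among three locations when the parties `a` and `b` come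
together in the location of `a` and the other two parties stand alone. -/
def bringTogether {a b : Fin 4} (hab : a ≠ b) (s : Fin 4) : {p : Fin 4 // p ≠ b} :=
  if hs : s = b then ⟨a, hab⟩ else ⟨s, hs⟩

end

/-! After a history the parties have applied a product operator, so each party holds a positive
local operator `MᴴM`. In a round only the factor of the measuring party changes, and the operators
of the possible outcomes sum to the previous one. Diagonal matrix elements of the product operator
between the given product states are outcome probabilities; off-diagonal ones measure lost
orthogonality.

Analytic half. Suppose that a product operator with nonvanishing diagonals preserves orthogonality
only if each factor is scalar (`LocallyIrreducible`). By compactness there is a small sphere around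
the maximally mixed operator on which every product operator with factors of trace one violates
orthogonality by a fixed amount (`exists_robust`). The protocol starts at the centre. While it stays
inside the ball, all states remain likely, so any guess is often wrong. A step out of the ball
crosses the sphere along a segment in one factor, where matrix elements are affine, so an end of the
step already violates orthogonality (`exists_violation_of_leave_ball`). Later rounds cannot repair a
violation: by the triangle inequality it persists in total, and by Cauchy–Schwarz it forces errors
at the end (`ofReal_norm_gram_le`). All these bounds are proportional to the product of local
traces, which is additive over outcomes. The total error is thus bounded below for every number of
rounds, which also rules out asymptotic discrimination (`exists_error_bound`).

Combinatorial half. The supports of the states partition the 81 computational cells into tiles of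
one or two cells. Preserving orthogonality makes the operator diagonal in the basis: its entries
between different tiles vanish, and its diagonal is constant on each tile. Comparing cells that
differ only at one location makes that factor scalar (`locallyIrreducible_basisState`). Some joint
locations can split off `|22⟩`; there the argument runs on the remaining states and coordinates,
which suffices for an error bound. -/

noncomputable section

/-! ### Sums over histories -/

open scoped ENNReal

/-- The sum of `f` over the histories that extend a given one by a single outcome. -/
def nextSum (f : List ℕ → ℝ≥0∞) (h : List ℕ) : ℝ≥0∞ := ∑' o, f (o :: h)

theorem nextSum_iterate_add (n : ℕ) (f g : List ℕ → ℝ≥0∞) :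
    nextSum^[n] (f + g) = nextSum^[n] f + nextSum^[n] g := by
  induction n generalizing f g with
  | zero => rfl
  | succ n ih =>
    have : nextSum (f + g) = nextSum f + nextSum g := by
      funext h
      exact ENNReal.tsum_add
    rw [Function.iterate_succ_apply, this, ih]
    rfl

theorem nextSum_iterate_sum {ι : Type*} (n : ℕ) (J : Finset ι) (f : ι → List ℕ → ℝ≥0∞) :
    nextSum^[n] (∑ i ∈ J, f i) = ∑ i ∈ J, nextSum^[n] (f i) := by
  classical
  induction J using Finset.induction_on with
  | empty =>
    simp only [Finset.sum_empty]
    have : nextSum 0 = 0 := by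
      funext h
      simp [nextSum]
    exact Function.iterate_fixed this n
  | insert i J hi ih => rw [Finset.sum_insert hi, Finset.sum_insert hi, nextSum_iterate_add, ih]

/-- Histories of length `n + 1` are obtained from histories of length `n` by one more outcome. -/
def historySuccEquiv (n : ℕ) :
    {h : List ℕ // h.length = n} × ℕ ≃ {h : List ℕ // h.length = n + 1} where
  toFun q := ⟨q.2 :: q.1.1, by simp [q.1.2]⟩
  invFun
    | ⟨o :: h, hh⟩ => (⟨h, by simpa using hh⟩, o)
  left_inv _ := rfl
  right_inv
    | ⟨_ :: _, _⟩ => rfl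

/-- The iterate can be evaluated at any history, not only the empty one; this is what permits
induction on the number of remaining rounds. -/
theorem tsum_length_eq_iterate (n : ℕ) (f : List ℕ → ℝ≥0∞) :
    ∑' h : {h : List ℕ // h.length = n}, f h = nextSum^[n] f [] := by
  induction n generalizing f with
  | zero =>
    rw [tsum_eq_single ⟨[], rfl⟩]
    · rfl
    · rintro ⟨h, hh⟩ hne
      exact absurd (Subtype.ext (List.length_eq_zero_iff.mp hh)) hne
  | succ n ih =>
    rw [Function.iterate_succ_apply, ← ih, ← (historySuccEquiv n).tsum_eq]
    exact ENNReal.tsum_prod (f := fun (h : {h : List ℕ // h.length = n}) o => f (o :: h.1))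

/-! ### Sesquilinear forms with Gram coefficients -/

section Form

variable {κ : Type*} [Fintype κ]

/-- The sesquilinear form with coefficients `B`. -/
def form (B : κ → κ → ℂ) (u w : κ → ℂ) : ℂ := ∑ x, ∑ y, star (u x) * B x y * w y

/-- The real part of the trace. -/
def reTrace (B : κ → κ → ℂ) : ℝ := ∑ x, (B x x).re

theorem form_smul (c : ℂ) (B : κ → κ → ℂ) (u w : κ → ℂ) : form (c • B) u w = c * form B u w := by
  simp only [form, Finset.mul_sum, Pi.smul_apply, smul_eq_mul]
  exact Finset.sum_congr rfl fun x _ => Finset.sum_congr rfl fun y _ => by ring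

theorem form_add (A B : κ → κ → ℂ) (u w : κ → ℂ) : form (A + B) u w = form A u w + form B u w := by
  simp only [form, ← Finset.sum_add_distrib, Pi.add_apply]
  exact Finset.sum_congr rfl fun x _ => Finset.sum_congr rfl fun y _ => by ring

@[fun_prop]
theorem continuous_form (u w : κ → ℂ) : Continuous fun B : κ → κ → ℂ => form B u w := by
  unfold form
  fun_prop

theorem hasSum_form {B : ℕ → κ → κ → ℂ} {A : κ → κ → ℂ} (hB : HasSum B A) (u w : κ → ℂ) :
    HasSum (fun o => form (B o) u w) (form A u w) := by
  refine hasSum_sum fun x _ => hasSum_sum fun y _ => ?_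
  exact ((Pi.hasSum.mp (Pi.hasSum.mp hB x) y).mul_left _).mul_right _

theorem hasSum_reTrace {B : ℕ → κ → κ → ℂ} {A : κ → κ → ℂ} (hB : HasSum B A) :
    HasSum (fun o => reTrace (B o)) (reTrace A) := by
  refine hasSum_sum fun x _ => ?_
  exact Complex.hasSum_re (Pi.hasSum.mp (Pi.hasSum.mp hB x) x)

theorem form_gram_eq_inner {m : ℕ} (M : Fin m → κ → ℂ) (u w : κ → ℂ) :
    form (fun x y => ∑ r, star (M r x) * M r y) u w =
      inner ℂ (WithLp.toLp 2 fun r => ∑ x, M r x * u x : EuclideanSpace ℂ (Fin m))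
        (WithLp.toLp 2 fun r => ∑ x, M r x * w x) := by
  simp only [form, PiLp.inner_apply, RCLike.inner_apply, map_sum, map_mul,
    Finset.sum_mul, Finset.mul_sum]
  have h : ∀ F : κ → κ → Fin m → ℂ, ∑ x, ∑ y, ∑ r, F x y r = ∑ r, ∑ y, ∑ x, F x y r := by
    intro F
    rw [Finset.sum_comm]
    simp only [Finset.sum_comm (s := (Finset.univ : Finset κ)) (t := (Finset.univ : Finset (Fin m)))]
  rw [h]
  refine Finset.sum_congr rfl fun r _ => ?_
  rw [Finset.sum_comm]
  refine Finset.sum_congr rfl fun x _ => Finset.sum_congr rfl fun y _ => ?_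
  simp only [RCLike.star_def]
  ring

/-- The coefficients `B` are those of `Mᴴ * M` for some matrix `M`. -/
def IsGram (B : κ → κ → ℂ) : Prop :=
  ∃ (m : ℕ) (M : Fin m → κ → ℂ), ∀ x y, B x y = ∑ r, star (M r x) * M r y

/-- Positivity and Cauchy–Schwarz for the form are inherited from this Euclidean inner product. -/
theorem IsGram.exists_form_eq_inner {B : κ → κ → ℂ} (hB : IsGram B) :
    ∃ (m : ℕ) (φ : (κ → ℂ) → EuclideanSpace ℂ (Fin m)), ∀ u w, form B u w = inner ℂ (φ u) (φ w) := by
  obtain ⟨m, M, hM⟩ := hB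
  obtain rfl : B = fun x y => ∑ r, star (M r x) * M r y := funext fun x => funext fun y => hM x y
  exact ⟨m, fun u => WithLp.toLp 2 fun r => ∑ x, M r x * u x, form_gram_eq_inner M⟩

theorem IsGram.form_self {B : κ → κ → ℂ} (hB : IsGram B) (u : κ → ℂ) :
    0 ≤ (form B u u).re ∧ form B u u = ((form B u u).re : ℂ) := by
  obtain ⟨m, φ, hφ⟩ := hB.exists_form_eq_inner
  have h : form B u u = ((‖φ u‖ ^ 2 : ℝ) : ℂ) := by
    rw [hφ, inner_self_eq_norm_sq_to_K]
    norm_cast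
  rw [h, Complex.ofReal_re]
  exact ⟨by positivity, rfl⟩

theorem IsGram.norm_form_sq_le {B : κ → κ → ℂ} (hB : IsGram B) (u w : κ → ℂ) :
    ‖form B u w‖ ^ 2 ≤ (form B u u).re * (form B w w).re := by
  obtain ⟨m, φ, hφ⟩ := hB.exists_form_eq_inner
  have h : ∀ u, (form B u u).re = ‖φ u‖ ^ 2 := fun u => by
    rw [hφ, inner_self_eq_norm_sq_to_K]
    norm_cast
  rw [h, h, hφ, ← mul_pow]
  gcongr
  exact norm_inner_le_norm _ _

theorem form_single [DecidableEq κ] (B : κ → κ → ℂ) (x y : κ) :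
    form B (Pi.single x 1) (Pi.single y 1) = B x y := by
  rw [form, Finset.sum_eq_single x, Finset.sum_eq_single y] <;>
    simp +contextual [Pi.single_apply, eq_comm]

theorem IsGram.diag_nonneg {B : κ → κ → ℂ} (hB : IsGram B) (x : κ) : 0 ≤ (B x x).re := by
  classical
  simpa [form_single] using (hB.form_self (Pi.single x 1)).1

theorem IsGram.diag_eq_re {B : κ → κ → ℂ} (hB : IsGram B) (x : κ) : B x x = ((B x x).re : ℂ) := by
  classical
  simpa [form_single] using (hB.form_self (Pi.single x 1)).2

theorem IsGram.reTrace_nonneg {B : κ → κ → ℂ} (hB : IsGram B) : 0 ≤ reTrace B :=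
  Finset.sum_nonneg fun x _ => hB.diag_nonneg x

theorem IsGram.norm_apply_le {B : κ → κ → ℂ} (hB : IsGram B) (x y : κ) : ‖B x y‖ ≤ reTrace B := by
  classical
  have h := hB.norm_form_sq_le (Pi.single x 1) (Pi.single y 1)
  simp only [form_single] at h
  have hx : ∀ x, (B x x).re ≤ reTrace B := fun x =>
    Finset.single_le_sum (f := fun x => (B x x).re) (fun z _ => hB.diag_nonneg z)
      (Finset.mem_univ x)
  refine abs_le_of_sq_le_sq' ?_ hB.reTrace_nonneg |>.2
  calc _ ≤ _ := h
    _ ≤ reTrace B * reTrace B := by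
      gcongr
      exacts [hB.diag_nonneg y, hB.reTrace_nonneg, hx x, hx y]
    _ = _ := by ring

theorem IsGram.norm_form_le {B : κ → κ → ℂ} (hB : IsGram B) (u w : κ → ℂ) :
    ‖form B u w‖ ≤ ((∑ x, ‖u x‖) * ∑ y, ‖w y‖) * reTrace B := by
  rw [Finset.sum_mul_sum, Finset.sum_mul]
  refine (norm_sum_le _ _).trans (Finset.sum_le_sum fun x _ => ?_)
  rw [Finset.sum_mul]
  refine (norm_sum_le _ _).trans (Finset.sum_le_sum fun y _ => ?_)
  rw [norm_mul, norm_mul, norm_star]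
  have := hB.norm_apply_le x y
  calc ‖u x‖ * ‖B x y‖ * ‖w y‖ ≤ ‖u x‖ * reTrace B * ‖w y‖ := by gcongr
    _ = _ := by ring

end Form

theorem IsGram.sum_inv_reTrace_smul {κ : Type*} [Fintype κ] {B : κ → κ → ℂ} (h : IsGram B)
    (hB : reTrace B ≠ 0) : ∑ x, ((reTrace B : ℂ)⁻¹ • B) x x = 1 := by
  simp only [Pi.smul_apply, smul_eq_mul, ← Finset.mul_sum]
  rw [Finset.sum_congr rfl fun x _ => h.diag_eq_re x, ← Complex.ofReal_sum]
  exact inv_mul_cancel₀ (by exact_mod_cast hB)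

/-! ### Product operators and robust local irreducibility -/

section Product

variable {P : Type*} [Fintype P] {κ : P → Type*} [∀ p, Fintype (κ p)]
  {ι : Type*}

/-- The matrix element of the product operator `⨂ B p` between two product vectors. -/
def gram (v : ι → ∀ p, κ p → ℂ) (B : ∀ p, κ p → κ p → ℂ) (i j : ι) : ℂ :=
  ∏ p, form (B p) (v i p) (v j p)

/-- The product over the parties of the local traces. -/
def weight (B : ∀ p, κ p → κ p → ℂ) : ℝ := ∏ p, reTrace (B p)

/-- The product operator whose local factors are rescaled to have trace `1`. -/
def normalized (B : ∀ p, κ p → κ p → ℂ) : ∀ p, κ p → κ p → ℂ :=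
  fun p => ((reTrace (B p) : ℂ)⁻¹) • B p

/-- The maximally mixed product operator. -/
def mixed [∀ p, DecidableEq (κ p)] : ∀ p, κ p → κ p → ℂ :=
  fun p x y => if x = y then (Fintype.card (κ p) : ℂ)⁻¹ else 0

/-- Used when only the factor of `a` varies: the matrix element is then linear in that factor, with
a fixed coefficient. -/
theorem gram_eq_mul_prod_erase [DecidableEq P] (v : ι → ∀ p, κ p → ℂ) {A B : ∀ p, κ p → κ p → ℂ} (a : P)
    (h : ∀ p, p ≠ a → B p = A p) (i j : ι) :
    gram v B i j = form (B a) (v i a) (v j a) *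
      ∏ p ∈ Finset.univ.erase a, form (A p) (v i p) (v j p) := by
  rw [gram, ← Finset.mul_prod_erase _ _ (Finset.mem_univ a)]
  congr 1
  exact Finset.prod_congr rfl fun p hp => by rw [h p (Finset.ne_of_mem_erase hp)]

theorem weight_eq_mul_prod_erase [DecidableEq P] {A B : ∀ p, κ p → κ p → ℂ} (a : P)
    (h : ∀ p, p ≠ a → B p = A p) :
    weight B = reTrace (B a) * ∏ p ∈ Finset.univ.erase a, reTrace (A p) := by
  rw [weight, ← Finset.mul_prod_erase _ _ (Finset.mem_univ a)]
  congr 1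
  exact Finset.prod_congr rfl fun p hp => by rw [h p (Finset.ne_of_mem_erase hp)]

theorem gram_eq_weight_mul (v : ι → ∀ p, κ p → ℂ) {B : ∀ p, κ p → κ p → ℂ}
    (hB : ∀ p, reTrace (B p) ≠ 0) (i j : ι) :
    gram v B i j = (weight B : ℂ) * gram v (normalized B) i j := by
  rw [gram, gram, weight, Complex.ofReal_prod, ← Finset.prod_mul_distrib]
  refine Finset.prod_congr rfl fun p _ => ?_
  rw [normalized, form_smul, mul_inv_cancel_left₀ (by exact_mod_cast hB p)]

@[fun_prop]
theorem continuous_gram (v : ι → ∀ p, κ p → ℂ) (i j : ι) :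
    Continuous fun B : ∀ p, κ p → κ p → ℂ => gram v B i j := by
  unfold gram
  refine continuous_finsetProd _ fun p _ => ?_
  exact (continuous_form (v i p) (v j p)).comp (continuous_apply p)

theorem IsGram.gram_self {B : ∀ p, κ p → κ p → ℂ} (h : ∀ p, IsGram (B p))
    (v : ι → ∀ p, κ p → ℂ) (i : ι) :
    gram v B i i = ((∏ p, (form (B p) (v i p) (v i p)).re : ℝ) : ℂ) := by
  rw [gram, Complex.ofReal_prod]
  exact Finset.prod_congr rfl fun p _ => ((h p).form_self _).2

theorem IsGram.gram_self_re_nonneg {B : ∀ p, κ p → κ p → ℂ} (h : ∀ p, IsGram (B p))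
    (v : ι → ∀ p, κ p → ℂ) (i : ι) : 0 ≤ (gram v B i i).re := by
  rw [IsGram.gram_self h, Complex.ofReal_re]
  exact Finset.prod_nonneg fun p _ => ((h p).form_self _).1

theorem IsGram.norm_gram_sq_le {B : ∀ p, κ p → κ p → ℂ} (h : ∀ p, IsGram (B p))
    (v : ι → ∀ p, κ p → ℂ) (i j : ι) :
    ‖gram v B i j‖ ^ 2 ≤ (gram v B i i).re * (gram v B j j).re := by
  rw [IsGram.gram_self h v i, IsGram.gram_self h v j, Complex.ofReal_re, Complex.ofReal_re,
    ← Finset.prod_mul_distrib, gram, norm_prod, ← Finset.prod_pow]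
  exact Finset.prod_le_prod (fun p _ => by positivity) fun p _ => (h p).norm_form_sq_le _ _

theorem IsGram.weight_nonneg {B : ∀ p, κ p → κ p → ℂ} (h : ∀ p, IsGram (B p)) : 0 ≤ weight B :=
  Finset.prod_nonneg fun p _ => (h p).reTrace_nonneg

/-- The entries of a positive matrix are bounded by its trace. Hence the weight, which does not
depend on the state, controls all outcome probabilities at once. -/
theorem exists_gram_self_le_weight (v : ι → ∀ p, κ p → ℂ) (J : Finset ι) :
    ∃ C : ℝ, 0 < C ∧ ∀ B : ∀ p, κ p → κ p → ℂ, (∀ p, IsGram (B p)) → ∀ i ∈ J,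
      (gram v B i i).re ≤ C * weight B := by
  have hnn : ∀ i, 0 ≤ ∏ p, ((∑ x, ‖v i p x‖) * ∑ y, ‖v i p y‖) := fun i =>
    Finset.prod_nonneg fun p _ => by positivity
  refine ⟨1 + ∑ i ∈ J, ∏ p, ((∑ x, ‖v i p x‖) * ∑ y, ‖v i p y‖), ?_, fun B hB i hi => ?_⟩
  · have := Finset.sum_nonneg fun i (_ : i ∈ J) => hnn i
    linarith
  · calc (gram v B i i).re ≤ ‖gram v B i i‖ := Complex.re_le_norm _
      _ ≤ ∏ p, (((∑ x, ‖v i p x‖) * ∑ y, ‖v i p y‖) * reTrace (B p)) := by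
        rw [gram, norm_prod]
        exact Finset.prod_le_prod (fun p _ => by positivity) fun p _ => (hB p).norm_form_le _ _
      _ = (∏ p, ((∑ x, ‖v i p x‖) * ∑ y, ‖v i p y‖)) * weight B := by
        rw [Finset.prod_mul_distrib, weight]
      _ ≤ _ := by
        have := IsGram.weight_nonneg hB
        gcongr
        have := Finset.single_le_sum (fun i _ => hnn i) hi
        linarith

variable [∀ p, DecidableEq (κ p)]

theorem gram_mixed_re_pos {v : ι → ∀ p, κ p → ℂ} {i : ι} (hv : ∀ p, v i p ≠ 0) :
    0 < (gram v mixed i i).re := by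
  have h : gram v mixed i i =
      ((∏ p, ((Fintype.card (κ p) : ℝ)⁻¹ * ∑ x, ‖v i p x‖ ^ 2) : ℝ) : ℂ) := by
    rw [gram, Complex.ofReal_prod]
    refine Finset.prod_congr rfl fun p _ => ?_
    simp only [form, mixed, mul_ite, ite_mul, mul_zero, zero_mul, Finset.sum_ite_eq,
      Finset.mem_univ, if_true]
    push_cast
    rw [Finset.mul_sum]
    refine Finset.sum_congr rfl fun x _ => ?_
    rw [← Complex.conj_mul', RCLike.star_def]
    ring
  rw [h, Complex.ofReal_re]
  refine Finset.prod_pos fun p _ => ?_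
  obtain ⟨x, hx⟩ := Function.ne_iff.mp (hv p)
  have : Nonempty (κ p) := ⟨x⟩
  refine mul_pos (inv_pos.mpr (by exact_mod_cast Fintype.card_pos)) ?_
  refine Finset.sum_pos' (fun x _ => by positivity) ⟨x, Finset.mem_univ _, ?_⟩
  have : 0 < ‖v i p x‖ := norm_pos_iff.mpr hx
  positivity

/-- Local irreducibility: a product operator with nonvanishing diagonals that preserves the
orthogonality of the product vectors is trivial. -/
def LocallyIrreducible (v : ι → ∀ p, κ p → ℂ) (J : Finset ι) : Prop :=
  ∀ B : ∀ p, κ p → κ p → ℂ, (∀ p x, B p x x ≠ 0) →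
    (∀ i ∈ J, ∀ j ∈ J, i ≠ j → gram v B i j = 0) →
      ∀ p, ∃ c : ℂ, B p = fun x y => if x = y then c else 0

/-- A locally irreducible family is robustly so: a normalized product operator at the right
distance from the maximally mixed one violates orthogonality by a fixed amount. -/
theorem LocallyIrreducible.exists_robust {v : ι → ∀ p, κ p → ℂ} {J : Finset ι}
    (hirr : LocallyIrreducible v J) (hJ : J.Nonempty) (hv : ∀ i ∈ J, ∀ p, v i p ≠ 0) :
    ∃ δ > 0, ∃ η > 0,
      (∀ B ∈ Metric.closedBall (mixed : ∀ p, κ p → κ p → ℂ) δ, ∀ i ∈ J, η ≤ (gram v B i i).re) ∧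
      ∀ B ∈ Metric.sphere (mixed : ∀ p, κ p → κ p → ℂ) δ, (∀ p, ∑ x, B p x x = 1) →
        ∃ i ∈ J, ∃ j ∈ J, i ≠ j ∧ η ≤ ‖gram v B i j‖ := by
  classical
  obtain ⟨i₀, hi₀⟩ := hJ
  have hne : ∀ p, Nonempty (κ p) := fun p =>
    let ⟨x, _⟩ := Function.ne_iff.mp (hv i₀ hi₀ p)
    ⟨x⟩
  obtain ⟨i₁, hi₁, hmin⟩ := J.exists_min_image (fun i => (gram v mixed i i).re) ⟨i₀, hi₀⟩
  set η₁ := (gram v mixed i₁ i₁).re / 2 with hη₁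
  have hpos := gram_mixed_re_pos (hv i₁ hi₁)
  have hη₁pos : 0 < η₁ := by positivity
  have h1 : ∀ᶠ B in nhds (mixed : ∀ p, κ p → κ p → ℂ), ∀ i ∈ J, η₁ < (gram v B i i).re := by
    rw [Filter.eventually_all_finset]
    intro i hi
    have hc : Continuous fun B : ∀ p, κ p → κ p → ℂ => (gram v B i i).re :=
      Complex.continuous_re.comp (continuous_gram v i i)
    have := hmin i hi
    exact hc.continuousAt.eventually (lt_mem_nhds (by linarith))
  -- Nonvanishing diagonals, required by local irreducibility, are an open condition that holds at
  -- the centre.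
  have h2 : ∀ᶠ B in nhds (mixed : ∀ p, κ p → κ p → ℂ), ∀ p x, B p x x ≠ 0 := by
    rw [Filter.eventually_all]
    intro p
    rw [Filter.eventually_all]
    intro x
    have hc : Continuous fun B : ∀ p, κ p → κ p → ℂ => B p x x := by fun_prop
    refine hc.continuousAt.eventually (isOpen_ne.mem_nhds ?_)
    simp [mixed]
  obtain ⟨ε, hε, hball⟩ := Metric.nhds_basis_closedBall.eventually_iff.mp (h1.and h2)
  -- The total violation of orthogonality: continuous, and zero only if every pair in `J` stays
  -- orthogonal.
  let D : (∀ p, κ p → κ p → ℂ) → ℝ := fun B =>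
    ∑ i ∈ J, ∑ j ∈ J, if i = j then 0 else ‖gram v B i j‖
  have hD : Continuous D := by
    refine continuous_finsetSum _ fun i _ => continuous_finsetSum _ fun j _ => ?_
    split_ifs
    · exact continuous_const
    · exact (continuous_gram v i j).norm
  have hcomp : IsCompact (Metric.sphere (mixed : ∀ p, κ p → κ p → ℂ) ε ∩
      {B | ∀ p, ∑ x, B p x x = 1}) := by
    refine (isCompact_sphere _ _).inter_right ?_
    simp only [Set.ofPred_forall]
    exact isClosed_iInter fun p => isClosed_eq (by fun_prop) continuous_const
  have hterm : ∀ B i j, 0 ≤ if i = j then 0 else ‖gram v B i j‖ := fun B i j => by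
    split_ifs <;> positivity
  have hDpos : ∀ B ∈ Metric.sphere (mixed : ∀ p, κ p → κ p → ℂ) ε ∩
      {B | ∀ p, ∑ x, B p x x = 1}, 0 < D B := by
    rintro B ⟨hBs, hBt⟩
    have hD0 : 0 ≤ D B := Finset.sum_nonneg fun i _ => Finset.sum_nonneg fun j _ => hterm B i j
    refine hD0.lt_of_ne' fun h0 => ?_
    have hz : ∀ i ∈ J, ∀ j ∈ J, i ≠ j → gram v B i j = 0 := by
      intro i hi j hj hij
      have := (Finset.sum_eq_zero_iff_of_nonneg fun i _ =>
        Finset.sum_nonneg fun j _ => hterm B i j).mp h0 i hi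
      have := (Finset.sum_eq_zero_iff_of_nonneg fun j _ => hterm B i j).mp this j hj
      simpa [hij] using this
    -- Scalar factors of trace one are maximally mixed, but the centre is not on the sphere.
    have hB : B = mixed := by
      funext p
      obtain ⟨c, hc⟩ := hirr B (hball (Metric.sphere_subset_closedBall hBs)).2 hz p
      have ht := hBt p
      rw [hc] at ht ⊢
      simp only [if_true, Finset.sum_const, Finset.card_univ, nsmul_eq_mul] at ht
      funext x y
      simp only [mixed, eq_inv_of_mul_eq_one_right ht]
    rw [hB, Metric.mem_sphere, dist_self] at hBs
    exact hε.ne hBs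
  obtain ⟨η₂, hη₂, hη₂D⟩ : ∃ η₂ > 0, ∀ B ∈ Metric.sphere (mixed : ∀ p, κ p → κ p → ℂ) ε ∩
      {B | ∀ p, ∑ x, B p x x = 1}, η₂ ≤ D B := by
    rcases Set.eq_empty_or_nonempty (Metric.sphere (mixed : ∀ p, κ p → κ p → ℂ) ε ∩
      {B | ∀ p, ∑ x, B p x x = 1}) with he | hn
    -- If no operator of trace one lies on the sphere, any positive constant serves.
    · exact ⟨1, one_pos, fun B hB => by simp [he] at hB⟩
    · obtain ⟨B₀, hB₀, hB₀min⟩ := hcomp.exists_isMinOn hn hD.continuousOn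
      exact ⟨D B₀, hDpos B₀ hB₀, fun B hB => hB₀min hB⟩
  have hcard : 0 < (J.card : ℝ) := by exact_mod_cast Finset.card_pos.mpr ⟨i₀, hi₀⟩
  -- If all `J.card ^ 2` terms were below this bound, the total violation would be at most `η₂ / 2`,
  -- contradicting its minimum `η₂`.
  refine ⟨ε, hε, min η₁ (η₂ / (2 * (J.card * J.card))), lt_min hη₁pos (by positivity),
    fun B hB i hi => (min_le_left _ _).trans ((hball hB).1 i hi).le, fun B hBs hBt => ?_⟩
  by_contra! hcon
  have hle : D B ≤ ∑ i ∈ J, ∑ j ∈ J, η₂ / (2 * (J.card * J.card)) := by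
    refine Finset.sum_le_sum fun i hi => Finset.sum_le_sum fun j hj => ?_
    split_ifs with hij
    · positivity
    · exact (hcon i hi j hj hij).le.trans (min_le_right _ _)
  simp only [Finset.sum_const, nsmul_eq_mul] at hle
  have h3 : (J.card : ℝ) * (J.card * (η₂ / (2 * (J.card * J.card)))) = η₂ / 2 := by
    field_simp
  have := hη₂D B ⟨hBs, hBt⟩
  linarith

/-- If changing one local factor leads out of the ball in which orthogonality violations are
controlled, then orthogonality is violated at one of the two ends. -/
theorem exists_violation_of_leave_ball [DecidableEq P] {v : ι → ∀ p, κ p → ℂ} {J : Finset ι} {δ η : ℝ}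
    (hδ : ∀ B ∈ Metric.sphere (mixed : ∀ p, κ p → κ p → ℂ) δ, (∀ p, ∑ x, B p x x = 1) →
        ∃ i ∈ J, ∃ j ∈ J, i ≠ j ∧ η ≤ ‖gram v B i j‖)
    {A B : ∀ p, κ p → κ p → ℂ} (a : P) (hAB : ∀ p, p ≠ a → B p = A p)
    (hA : ∀ p, ∑ x, A p x x = 1) (hB : ∀ p, ∑ x, B p x x = 1)
    (hAin : A ∈ Metric.closedBall (mixed : ∀ p, κ p → κ p → ℂ) δ)
    (hBout : B ∉ Metric.closedBall (mixed : ∀ p, κ p → κ p → ℂ) δ) :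
    ∃ i ∈ J, ∃ j ∈ J, i ≠ j ∧ (η ≤ ‖gram v A i j‖ ∨ η ≤ ‖gram v B i j‖) := by
  let S : ℝ → ∀ p, κ p → κ p → ℂ := fun t => (1 - t) • A + t • B
  have hS : Continuous fun t => dist (S t) mixed := by
    refine Continuous.dist ?_ continuous_const
    fun_prop
  have h0 : S 0 = A := by simp [S]
  have h1 : S 1 = B := by simp [S]
  obtain ⟨t, ⟨ht0, ht1⟩, ht⟩ := intermediate_value_Icc zero_le_one hS.continuousOn
    (show δ ∈ Set.Icc (dist (S 0) mixed) (dist (S 1) mixed) by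
      rw [h0, h1]
      exact ⟨hAin, (not_le.mp hBout).le⟩)
  obtain ⟨i, hi, j, hj, hij, hle⟩ := hδ (S t) ht fun p => by
    simp only [S, Pi.add_apply, Pi.smul_apply, Finset.sum_add_distrib, ← Finset.smul_sum, hA, hB]
    simp
  refine ⟨i, hi, j, hj, hij, ?_⟩
  have hSt : ∀ p, p ≠ a → S t p = A p := fun p hp => by
    simp only [S, Pi.add_apply, Pi.smul_apply, hAB p hp]
    rw [← add_smul]
    simp
  -- The matrix element is affine along the segment because only the factor of `a` moves. A large
  -- value in between therefore forces one at an end.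
  have hgram : gram v (S t) i j = ((1 - t : ℝ) : ℂ) * gram v A i j + (t : ℂ) * gram v B i j := by
    rw [gram_eq_mul_prod_erase v a hSt, gram_eq_mul_prod_erase v a hAB,
      gram_eq_mul_prod_erase v a (fun p _ => rfl : ∀ p, p ≠ a → A p = A p)]
    have : S t a = ((1 - t : ℝ) : ℂ) • A a + (t : ℂ) • B a := by
      funext x y
      simp [S]
    rw [this, form_add, form_smul, form_smul]
    ring
  by_contra! hcon
  have : ‖gram v (S t) i j‖ ≤ (1 - t) * ‖gram v A i j‖ + t * ‖gram v B i j‖ := by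
    rw [hgram]
    refine (norm_add_le _ _).trans ?_
    rw [norm_mul, norm_mul, Complex.norm_of_nonneg (by linarith), Complex.norm_of_nonneg ht0]
  have hmax := max_lt hcon.1 hcon.2
  have hl := mul_le_mul_of_nonneg_left (le_max_left ‖gram v A i j‖ ‖gram v B i j‖)
    (sub_nonneg.mpr ht1)
  have hr := mul_le_mul_of_nonneg_left (le_max_right ‖gram v A i j‖ ‖gram v B i j‖) ht0
  linarith

end Product

/-! ### Lower bound for the error in a protocol tree -/

section Tree

variable {P : Type*} [Fintype P] [DecidableEq P] {κ : P → Type*} [∀ p, Fintype (κ p)]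
  {ι : Type*}

/-- The local positive operators `E h p` of the parties after the history `h`, in a protocol in
which the party `actor h` measures next. -/
structure IsProtocolTree (actor : List ℕ → P) (E : List ℕ → ∀ p, κ p → κ p → ℂ) : Prop where
  isGram : ∀ h p, IsGram (E h p)
  hasSum : ∀ h, HasSum (fun o => E (o :: h) (actor h)) (E h (actor h))
  eq_of_ne : ∀ h o p, p ≠ actor h → E (o :: h) p = E h p

/-- The total probability, over the states in `J`, of a wrong guess after the history `h`. -/
def errorAt [DecidableEq ι] (v : ι → ∀ p, κ p → ℂ) (J : Finset ι) (guess : List ℕ → ι)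
    (E : List ℕ → ∀ p, κ p → κ p → ℂ) (h : List ℕ) : ℝ≥0∞ :=
  ∑ i ∈ J, if guess h = i then 0 else ENNReal.ofReal (gram v (E h) i i).re

namespace IsProtocolTree

variable {actor : List ℕ → P} {E : List ℕ → ∀ p, κ p → κ p → ℂ}

theorem hasSum_gram (hE : IsProtocolTree actor E) (v : ι → ∀ p, κ p → ℂ) (h : List ℕ) (i j : ι) :
    HasSum (fun o => gram v (E (o :: h)) i j) (gram v (E h) i j) := by
  rw [gram_eq_mul_prod_erase v (actor h) (fun p _ => rfl : ∀ p, p ≠ actor h → E h p = E h p)]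
  simp_rw [fun o => gram_eq_mul_prod_erase v (actor h) (hE.eq_of_ne h o) i j]
  exact (hasSum_form (hE.hasSum h) _ _).mul_right _

theorem hasSum_weight (hE : IsProtocolTree actor E) (h : List ℕ) :
    HasSum (fun o => weight (E (o :: h))) (weight (E h)) := by
  rw [weight_eq_mul_prod_erase (actor h) (fun p _ => rfl : ∀ p, p ≠ actor h → E h p = E h p)]
  simp_rw [fun o => weight_eq_mul_prod_erase (actor h) (hE.eq_of_ne h o)]
  exact (hasSum_reTrace (hE.hasSum h)).mul_right _

theorem tsum_weight (hE : IsProtocolTree actor E) (h : List ℕ) {c : ℝ} (hc : 0 ≤ c) :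
    ∑' o, ENNReal.ofReal (c * weight (E (o :: h))) = ENNReal.ofReal (c * weight (E h)) := by
  have hs := (hE.hasSum_weight h).mul_left c
  rw [← hs.tsum_eq, ENNReal.ofReal_tsum_of_nonneg _ hs.summable]
  exact fun o => mul_nonneg hc (IsGram.weight_nonneg (hE.isGram _))

/-- Conservation of probability, as a fixed-point equation that can be iterated over rounds. -/
theorem nextSum_gram_self (hE : IsProtocolTree actor E) (v : ι → ∀ p, κ p → ℂ) (i : ι) :
    nextSum (fun h => ENNReal.ofReal (gram v (E h) i i).re) =
      fun h => ENNReal.ofReal (gram v (E h) i i).re := by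
  funext h
  have hs := Complex.hasSum_re (hE.hasSum_gram v h i i)
  rw [nextSum, ← hs.tsum_eq, ENNReal.ofReal_tsum_of_nonneg _ hs.summable]
  exact fun o => IsGram.gram_self_re_nonneg (hE.isGram _) v i

theorem ofReal_norm_gram_le_tsum (hE : IsProtocolTree actor E) (v : ι → ∀ p, κ p → ℂ)
    (h : List ℕ) (i j : ι) {c : ℝ} (hc : 0 ≤ c) :
    ENNReal.ofReal (c * ‖gram v (E h) i j‖) ≤
      ∑' o, ENNReal.ofReal (c * ‖gram v (E (o :: h)) i j‖) := by
  simp_rw [ENNReal.ofReal_mul hc, ENNReal.tsum_mul_left, ofReal_norm]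
  rw [← (hE.hasSum_gram v h i j).tsum_eq]
  gcongr
  exact enorm_tsum_le_tsum_enorm

/-- Whatever the further course of the protocol, a violation of orthogonality costs errors. -/
theorem ofReal_norm_gram_le [DecidableEq ι] (hE : IsProtocolTree actor E)
    {v : ι → ∀ p, κ p → ℂ} {J : Finset ι}
    (guess : List ℕ → ι) {C c : ℝ} (hC0 : 0 < C) (hc : 0 ≤ c)
    (hC : ∀ B : ∀ p, κ p → κ p → ℂ, (∀ p, IsGram (B p)) → ∀ i ∈ J,
      (gram v B i i).re ≤ C * weight B)
    {i j : ι} (hi : i ∈ J) (hj : j ∈ J) (hij : i ≠ j) (m : ℕ) (h : List ℕ) :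
    ENNReal.ofReal (2 * c * ‖gram v (E h) i j‖) ≤
      nextSum^[m] (errorAt v J guess E) h + ENNReal.ofReal (c ^ 2 * C * weight (E h)) := by
  induction m generalizing h with
  | zero =>
    have hgram := hE.isGram h
    -- With `p` and `q` the probabilities of `i` and `j`, one has `2c√(pq) ≤ p + c²q`. A wrong guess
    -- for `i` pays for `p`, and the weight bounds `q`. The guess misses at least one of two
    -- distinct states.
    have hmain : ∀ i ∈ J, ∀ j ∈ J, guess h ≠ i →
        ENNReal.ofReal (2 * c * √((gram v (E h) i i).re * (gram v (E h) j j).re)) ≤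
          errorAt v J guess E h + ENNReal.ofReal (c ^ 2 * C * weight (E h)) := by
      intro i hi j hj hg
      have hle : ENNReal.ofReal (gram v (E h) i i).re ≤ errorAt v J guess E h := by
        refine le_trans ?_ (Finset.single_le_sum
          (f := fun i => if guess h = i then 0 else ENNReal.ofReal (gram v (E h) i i).re)
          (fun i _ => zero_le) hi)
        simp [hg]
      refine le_trans ?_ (add_le_add_left hle _)
      have h1 := IsGram.gram_self_re_nonneg hgram v i
      have h2 := IsGram.gram_self_re_nonneg hgram v j
      rw [← ENNReal.ofReal_add h1
        (mul_nonneg (by positivity) (IsGram.weight_nonneg hgram))]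
      refine ENNReal.ofReal_le_ofReal ?_
      rw [Real.sqrt_mul h1]
      have h3 := mul_le_mul_of_nonneg_left (hC _ hgram j hj) (sq_nonneg c)
      have h4 := Real.sq_sqrt h1
      have h5 := Real.sq_sqrt h2
      have h6 := sq_nonneg (√(gram v (E h) i i).re - c * √(gram v (E h) j j).re)
      have h7 : (c * √(gram v (E h) j j).re) ^ 2 = c ^ 2 * (gram v (E h) j j).re := by
        rw [mul_pow, h5]
      nlinarith
    have hle : 2 * c * ‖gram v (E h) i j‖ ≤
        2 * c * √((gram v (E h) i i).re * (gram v (E h) j j).re) := by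
      gcongr
      exact Real.le_sqrt_of_sq_le (IsGram.norm_gram_sq_le hgram v i j)
    refine (ENNReal.ofReal_le_ofReal hle).trans ?_
    by_cases hg : guess h = i
    · rw [mul_comm (gram v (E h) i i).re]
      exact hmain j hj i hi (hg ▸ hij)
    · exact hmain i hi j hj hg
  | succ m ih =>
    -- Over the next outcome the left side is subadditive and the weight additive, so the inequality
    -- passes from the children to the parent.
    rw [Function.iterate_succ_apply', nextSum]
    refine (hE.ofReal_norm_gram_le_tsum v h i j (by positivity)).trans ?_
    rw [← hE.tsum_weight h (by positivity), ← ENNReal.tsum_add]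
    exact ENNReal.tsum_le_tsum fun o => ih (o :: h)

variable [∀ p, DecidableEq (κ p)]

/-- In every protocol tree that starts from the identity, locally irreducible product vectors are
guessed wrongly with a probability that is bounded away from zero. -/
theorem exists_error_bound [DecidableEq ι] (hE : IsProtocolTree actor E)
    {v : ι → ∀ p, κ p → ℂ} {J : Finset ι}
    (guess : List ℕ → ι) (hroot : ∀ p, E [] p = fun x y => if x = y then 1 else 0)
    (hirr : LocallyIrreducible v J) (hJ : J.Nontrivial) (hv : ∀ i ∈ J, ∀ p, v i p ≠ 0) :
    ∃ c : ℝ, 0 < c ∧ ∀ n, ENNReal.ofReal c ≤ nextSum^[n] (errorAt v J guess E) [] := by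
  obtain ⟨i₀, hi₀, i₁, hi₁, h01⟩ := hJ
  obtain ⟨δ, hδ, η, hη, hball, hsphere⟩ := hirr.exists_robust ⟨i₀, hi₀⟩ hv
  obtain ⟨C, hC0, hC⟩ := exists_gram_self_le_weight v J
  set k := min η (η ^ 2 / C) with hk
  have hkpos : 0 < k := by positivity
  have hviol : ∀ m h, (∀ p, 0 < reTrace (E h p)) →
      (∃ i ∈ J, ∃ j ∈ J, i ≠ j ∧ η ≤ ‖gram v (normalized (E h)) i j‖) →
      ENNReal.ofReal (k * weight (E h)) ≤ nextSum^[m] (errorAt v J guess E) h := by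
    rintro m h hpos ⟨i, hi, j, hj, hij, hle⟩
    have hW : 0 < weight (E h) := Finset.prod_pos fun p _ => hpos p
    have h1 := hE.ofReal_norm_gram_le guess hC0 (c := η / C) (by positivity) hC hi hj hij m h
    have h2 : weight (E h) * η ≤ ‖gram v (E h) i j‖ := by
      rw [gram_eq_weight_mul v (fun p => (hpos p).ne'), norm_mul, Complex.norm_of_nonneg hW.le]
      gcongr
    refine ENNReal.le_of_add_le_add_right ENNReal.ofReal_ne_top (le_trans ?_ h1)
    rw [← ENNReal.ofReal_add (by positivity) (by positivity)]
    refine ENNReal.ofReal_le_ofReal ?_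
    calc k * weight (E h) + (η / C) ^ 2 * C * weight (E h)
        ≤ η ^ 2 / C * weight (E h) + (η / C) ^ 2 * C * weight (E h) := by
          gcongr
          exact min_le_right _ _
      _ = 2 * (η / C) * (weight (E h) * η) := by
          field_simp
          ring
      _ ≤ _ := by gcongr
  have hmain : ∀ m h, (∀ p, 0 < reTrace (E h p)) →
      normalized (E h) ∈ Metric.closedBall (mixed : ∀ p, κ p → κ p → ℂ) δ →
      ENNReal.ofReal (k * weight (E h)) ≤ nextSum^[m] (errorAt v J guess E) h := by
    intro m
    induction m with
    | zero =>
      intro h hpos hnear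
      have hW : 0 < weight (E h) := Finset.prod_pos fun p _ => hpos p
      -- When the protocol ends inside the ball, some state other than the guess still has
      -- probability at least `η` times the weight.
      obtain ⟨i, hi, hg⟩ : ∃ i ∈ J, guess h ≠ i := by
        by_cases hg : guess h = i₀
        · exact ⟨i₁, hi₁, hg ▸ h01⟩
        · exact ⟨i₀, hi₀, hg⟩
      refine le_trans ?_ (Finset.single_le_sum
        (f := fun i => if guess h = i then 0 else ENNReal.ofReal (gram v (E h) i i).re)
        (fun i _ => zero_le) hi)
      rw [if_neg hg]
      refine ENNReal.ofReal_le_ofReal ?_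
      rw [gram_eq_weight_mul v (fun p => (hpos p).ne'), Complex.re_ofReal_mul, mul_comm]
      gcongr
      exact (min_le_left _ _).trans (hball _ hnear i hi)
    | succ m ih =>
      intro h hpos hnear
      by_cases hbad : ∃ i ∈ J, ∃ j ∈ J, i ≠ j ∧ η ≤ ‖gram v (normalized (E h)) i j‖
      · exact hviol _ h hpos hbad
      rw [Function.iterate_succ_apply', nextSum, ← hE.tsum_weight h hkpos.le]
      refine ENNReal.tsum_le_tsum fun o => ?_
      -- An outcome of trace zero cannot be normalized, but it has weight zero and needs no bound.
      rcases ((hE.isGram (o :: h) (actor h)).reTrace_nonneg).eq_or_lt with h0 | h0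
      · have : weight (E (o :: h)) = 0 := Finset.prod_eq_zero (Finset.mem_univ (actor h)) h0.symm
        simp [this]
      have hpos' : ∀ p, 0 < reTrace (E (o :: h) p) := by
        intro p
        by_cases hp : p = actor h
        · rwa [hp]
        · rw [hE.eq_of_ne h o p hp]
          exact hpos p
      by_cases hin : normalized (E (o :: h)) ∈ Metric.closedBall (mixed : ∀ p, κ p → κ p → ℂ) δ
      · exact ih (o :: h) hpos' hin
      -- The step leaves the ball. The parent has no violation by `hbad`, so the child has one.
      obtain ⟨i, hi, j, hj, hij, hv | hv⟩ := exists_violation_of_leave_ball hsphere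
        (A := normalized (E h)) (B := normalized (E (o :: h))) (actor h)
        (fun p hp => by rw [normalized, normalized, hE.eq_of_ne h o p hp])
        (fun p => (hE.isGram h p).sum_inv_reTrace_smul (hpos p).ne')
        (fun p => (hE.isGram (o :: h) p).sum_inv_reTrace_smul (hpos' p).ne') hnear hin
      · exact absurd ⟨i, hi, j, hj, hij, hv⟩ hbad
      · exact hviol m (o :: h) hpos' ⟨i, hi, j, hj, hij, hv⟩
  have htr : ∀ p, reTrace (E [] p) = Fintype.card (κ p) := fun p => by simp [reTrace, hroot]
  have hpos : ∀ p, 0 < reTrace (E [] p) := fun p => by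
    obtain ⟨x, _⟩ := Function.ne_iff.mp (hv i₀ hi₀ p)
    rw [htr]
    exact_mod_cast Fintype.card_pos_iff.mpr ⟨x⟩
  have hnear : normalized (E []) = mixed := by
    funext p x y
    rw [normalized, htr]
    simp [mixed, hroot]
  refine ⟨k * weight (E []), mul_pos hkpos (Finset.prod_pos fun p _ => hpos p), fun n =>
    hmain n [] hpos ?_⟩
  rw [hnear]
  exact Metric.mem_closedBall_self hδ.le

end IsProtocolTree

end Tree

/-! ### From LOCC protocols to protocol trees -/

section Bridge

variable {S P : Type} {d : ℕ} {π : S → P}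

/-- A joint index is the same as a family of local indices. -/
def localIndexEquiv (d : ℕ) (π : S → P) : (S → Fin d) ≃ ∀ p, LocalIndex d π p where
  toFun x _ s := x s
  invFun f s := f (π s) ⟨s, rfl⟩
  left_inv _ := rfl
  right_inv f := by
    funext p ⟨s, hs⟩
    subst hs
    rfl

variable [Fintype S] [DecidableEq P]

/-- The tensor product of the factors that the party `p` holds. -/
def localFactor {ι : Type} (π : S → P) (w : ι → S → Fin d → ℂ) (i : ι) (p : P)
    (z : LocalIndex d π p) : ℂ :=
  ∏ s : {s : S // π s = p}, w i s (z s)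

namespace LOCCProtocol

variable {ι : Type}

/-- The positive operator of party `p` after the history `h`, compressed to the span of the local
basis vectors with `K p`. -/
def compressedOp (T : LOCCProtocol d π ι) (K : ∀ p, LocalIndex d π p → Prop) (h : List ℕ) (p : P)
    (x y : {z // K p z}) : ℂ :=
  ∑ r, star (T.localOp h p r x) * T.localOp h p r y

theorem compressedOp_eq (T : LOCCProtocol d π ι) (K : ∀ p, LocalIndex d π p → Prop) (h : List ℕ)
    (p : P) (x y : {z // K p z}) :
    T.compressedOp K h p x y = ((T.localOp h p).conjTranspose * T.localOp h p) x y := rfl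

theorem conjTranspose_localOp_cons_mul (T : LOCCProtocol d π ι) (h : List ℕ) (o : ℕ) (p : P) :
    (T.localOp (o :: h) p).conjTranspose * T.localOp (o :: h) p =
      (T.localOp h p).conjTranspose * ((T.op h o p).conjTranspose * T.op h o p) *
        T.localOp h p := by
  simp only [localOp, Matrix.conjTranspose_mul, Matrix.mul_assoc]

/-- Conjugating the completeness relation by the operator applied so far gives the sum rule;
isometries of the other parties cancel. Compression merely selects a principal block. -/
theorem isProtocolTree_compressedOp (T : LOCCProtocol d π ι)
    (K : ∀ p, LocalIndex d π p → Prop) [∀ p, DecidablePred (K p)] :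
    IsProtocolTree T.actor (T.compressedOp K) where
  isGram h p := ⟨_, fun r x => T.localOp h p r x, fun _ _ => rfl⟩
  hasSum h := by
    let F : Matrix (Fin (T.dim h (T.actor h))) (Fin (T.dim h (T.actor h))) ℂ →+
        Matrix (LocalIndex d π (T.actor h)) (LocalIndex d π (T.actor h)) ℂ :=
      { toFun := fun N => (T.localOp h (T.actor h)).conjTranspose * N * T.localOp h (T.actor h)
        map_zero' := by simp
        map_add' := fun M N => by rw [Matrix.mul_add, Matrix.add_mul] }
    have hF : Continuous F :=
      (continuous_const.matrix_mul continuous_id).matrix_mul continuous_const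
    have hs := (T.complete h).map F hF
    have h1 : F 1 = (T.localOp h (T.actor h)).conjTranspose * T.localOp h (T.actor h) := by
      simp [F]
    rw [h1] at hs
    refine Pi.hasSum.mpr fun x => Pi.hasSum.mpr fun y => ?_
    have := Pi.hasSum.mp (Pi.hasSum.mp hs x) y
    have heq : ∀ o, T.compressedOp K (o :: h) (T.actor h) x y =
        F ((T.op h o (T.actor h)).conjTranspose * T.op h o (T.actor h)) x y := fun o => by
      rw [compressedOp_eq, conjTranspose_localOp_cons_mul]
      rfl
    simp_rw [heq]
    exact this
  eq_of_ne h o p hp := by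
    funext x y
    rw [compressedOp_eq, compressedOp_eq, conjTranspose_localOp_cons_mul, T.op_isometry h o p hp,
      Matrix.mul_one]

theorem compressedOp_nil (T : LOCCProtocol d π ι) (K : ∀ p, LocalIndex d π p → Prop) (p : P) :
    T.compressedOp K [] p = fun x y => if x = y then 1 else 0 := by
  funext x y
  rw [compressedOp_eq, localOp, T.prep_isometry, Matrix.one_apply]
  simp only [Subtype.ext_iff]

end LOCCProtocol

variable [Fintype P]

theorem prod_localFactor {ι : Type} (w : ι → S → Fin d → ℂ) (i : ι) (x : S → Fin d) :
    ∏ p, localFactor π w i p (fun s => x s) = ∏ s, w i s (x s) :=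
  Fintype.prod_fiberwise π fun s => w i s (x s)

variable [DecidableEq S]

theorem sum_prod_localIndex {R : Type*} [CommSemiring R] (f : ∀ p, LocalIndex d π p → R) :
    ∑ x : S → Fin d, ∏ p, f p (fun s => x s) = ∏ p, ∑ z, f p z := by
  rw [Finset.prod_univ_sum, Fintype.piFinset_univ]
  exact (localIndexEquiv d π).sum_comp fun z => ∏ p, f p (z p)

namespace LOCCProtocol

variable {ι : Type}

theorem output_prod (T : LOCCProtocol d π ι) (w : ι → S → Fin d → ℂ) (h : List ℕ) (i : ι)
    (y : ∀ p, Fin (T.dim h p)) :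
    T.output h (WithLp.toLp 2 fun x => ∏ s, w i s (x s)) y =
      ∏ p, ∑ z, T.localOp h p (y p) z * localFactor π w i p z := by
  rw [← sum_prod_localIndex (π := π)
    fun p z => T.localOp h p (y p) z * localFactor π w i p z]
  simp only [output, Finset.prod_mul_distrib, prod_localFactor]

/-- The Born rule in factored form. Compression loses nothing for states whose local factors are
supported in `K`. -/
theorem gram_compressedOp_self (T : LOCCProtocol d π ι) {K : ∀ p, LocalIndex d π p → Prop}
    [∀ p, DecidablePred (K p)] (w : ι → S → Fin d → ℂ) (i : ι)
    (hK : ∀ p z, localFactor π w i p z ≠ 0 → K p z) (h : List ℕ) :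
    (gram (fun i p (z : {z // K p z}) => localFactor π w i p z) (T.compressedOp K h) i i).re =
      ‖T.output h (WithLp.toLp 2 fun x => ∏ s, w i s (x s))‖ ^ 2 := by
  have hsub : ∀ p r, ∑ z : {z // K p z}, T.localOp h p r z * localFactor π w i p z =
      ∑ z, T.localOp h p r z * localFactor π w i p z := by
    intro p r
    rw [← Finset.sum_filter_of_ne (p := K p) fun z _ hz => hK p z (right_ne_zero_of_mul hz)]
    exact (Finset.sum_subtype _ (by simp)
      fun z => T.localOp h p r z * localFactor π w i p z).symm
  have h1 : ∀ p, form (T.compressedOp K h p) (fun z => localFactor π w i p z)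
      (fun z => localFactor π w i p z) =
        ((∑ r, ‖∑ z, T.localOp h p r z * localFactor π w i p z‖ ^ 2 : ℝ) : ℂ) := by
    intro p
    have := form_gram_eq_inner (fun r (x : {z // K p z}) => T.localOp h p r x)
      (fun z => localFactor π w i p z) (fun z => localFactor π w i p z)
    rw [inner_self_eq_norm_sq_to_K] at this
    refine this.trans ?_
    norm_cast
    rw [EuclideanSpace.norm_sq_eq]
    simp only [hsub]
    rfl
  rw [gram]
  simp only [h1]
  rw [← Complex.ofReal_prod, Complex.ofReal_re, EuclideanSpace.norm_sq_eq, Finset.prod_univ_sum,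
    Fintype.piFinset_univ]
  refine Finset.sum_congr rfl fun y _ => ?_
  rw [output_prod, norm_prod, Finset.prod_pow]

theorem guessProb_eq_iterate [DecidableEq ι] (T : LOCCProtocol d π ι) (n : ℕ)
    (ψ : EuclideanSpace ℂ (S → Fin d)) (i : ι) :
    T.guessProb n ψ i =
      nextSum^[n] (fun h => if T.guess h = i then ‖T.output h ψ‖ₑ ^ 2 else 0) [] := by
  rw [← tsum_length_eq_iterate, guessProb]
  have h1 := tsum_subtype {h : List ℕ | h.length = n ∧ T.guess h = i}
    fun h => ‖T.output h ψ‖ₑ ^ 2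
  have h2 := tsum_subtype {h : List ℕ | h.length = n}
    fun h => if T.guess h = i then ‖T.output h ψ‖ₑ ^ 2 else 0
  refine h1.trans (Eq.trans ?_ h2.symm)
  refine tsum_congr fun h => ?_
  simp only [Set.indicator_apply, Set.mem_ofPred_eq]
  split_ifs <;> simp_all

end LOCCProtocol

/-- Product states with a locally irreducible subfamily in a product of local coordinate subspaces
are not distinguishable by LOCC, not even asymptotically. -/
theorem LocallyIrreducible.not_LOCCDistinguishable {ι : Type} {w : ι → S → Fin d → ℂ}
    (hw : ∀ i, ‖(WithLp.toLp 2 fun x => ∏ s, w i s (x s) : EuclideanSpace ℂ (S → Fin d))‖ = 1)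
    {K : ∀ p, LocalIndex d π p → Prop} [∀ p, DecidablePred (K p)] {J : Finset ι} (hJ : J.Nontrivial)
    (hK : ∀ i ∈ J, ∀ p z, localFactor π w i p z ≠ 0 → K p z)
    (hirr : LocallyIrreducible (fun i p (z : {z // K p z}) => localFactor π w i p z) J) :
    ¬ LOCCDistinguishable π fun i =>
      (WithLp.toLp 2 fun x => ∏ s, w i s (x s) : EuclideanSpace ℂ (S → Fin d)) := by
  classical
  rintro ⟨T, hT⟩
  set ψ : ι → EuclideanSpace ℂ (S → Fin d) := fun i => WithLp.toLp 2 fun x => ∏ s, w i s (x s)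
  set v : ι → ∀ p, {z // K p z} → ℂ := fun i p z => localFactor π w i p z
  have htree := T.isProtocolTree_compressedOp K
  have hv : ∀ i ∈ J, ∀ p, v i p ≠ 0 := by
    intro i hi p h0
    have hne : ψ i ≠ 0 := norm_ne_zero_iff.mp (by rw [hw i]; exact one_ne_zero)
    refine hne (PiLp.ext fun x => ?_)
    change ∏ s, w i s (x s) = 0
    rw [← prod_localFactor (π := π)]
    refine Finset.prod_eq_zero (Finset.mem_univ p) (by_contra fun hx => hx ?_)
    exact congrFun h0 ⟨_, hK i hi p _ hx⟩
  obtain ⟨c, hc, hbound⟩ :=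
    htree.exists_error_bound T.guess (T.compressedOp_nil K) hirr hJ hv
  have hf : ∀ i ∈ J, ∀ h, ENNReal.ofReal (gram v (T.compressedOp K h) i i).re =
      ‖T.output h (ψ i)‖ₑ ^ 2 := fun i hi h => by
    rw [T.gram_compressedOp_self w i (hK i hi) h, ENNReal.ofReal_pow (norm_nonneg _), ofReal_norm]
  have hroot : ∀ i ∈ J, (gram v (T.compressedOp K []) i i).re = 1 := by
    intro i hi
    have h1 : ∀ p, form (T.compressedOp K [] p) (v i p) (v i p) =
        ((∑ z, ‖localFactor π w i p z‖ ^ 2 : ℝ) : ℂ) := by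
      intro p
      have hz : ∑ z with K p z, ‖localFactor π w i p z‖ ^ 2 =
          ∑ z : {z // K p z}, ‖localFactor π w i p z‖ ^ 2 :=
        Finset.sum_subtype _ (by simp) fun z => ‖localFactor π w i p z‖ ^ 2
      rw [← Finset.sum_filter_of_ne (p := K p) fun z _ hz =>
        hK i hi p z fun h0 => hz (by simp [h0]), hz, T.compressedOp_nil]
      simp [form, v, ← Complex.conj_mul']
    rw [gram]
    simp only [h1]
    rw [← Complex.ofReal_prod, Complex.ofReal_re, ← sum_prod_localIndex]
    simp only [Finset.prod_pow, ← norm_prod, prod_localFactor]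
    have h2 := hw i
    rw [← sq_eq_sq₀ (norm_nonneg _) zero_le_one, EuclideanSpace.norm_sq_eq, one_pow] at h2
    exact h2
  -- Correct and wrong guesses together exhaust the conserved probability, which is `1` at the root.
  have htotal : ∀ i ∈ J, ∀ n, T.guessProb n (ψ i) i + nextSum^[n] (fun h =>
      if T.guess h = i then 0 else ENNReal.ofReal (gram v (T.compressedOp K h) i i).re) [] = 1 := by
    intro i hi n
    rw [T.guessProb_eq_iterate, ← Pi.add_apply, ← nextSum_iterate_add]
    have : ((fun h => if T.guess h = i then ‖T.output h (ψ i)‖ₑ ^ 2 else 0) + fun h =>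
        if T.guess h = i then 0 else ENNReal.ofReal (gram v (T.compressedOp K h) i i).re) =
        fun h => ENNReal.ofReal (gram v (T.compressedOp K h) i i).re := by
      funext h
      rw [Pi.add_apply, hf i hi]
      split_ifs <;> simp
    rw [this, Function.iterate_fixed (htree.nextSum_gram_self v i)]
    simp only [hroot i hi, ENNReal.ofReal_one]
  -- Chosen so that `J.card * ε < c`, against the error bound; the cap `1` keeps `1 - ε`
  -- nonnegative.
  set ε : ℝ := min 1 (c / (J.card + 1)) with hε
  have hεpos : 0 < ε := by positivity
  obtain ⟨n, hn⟩ := hT (ENNReal.ofReal (1 - ε)) (by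
    rw [← ENNReal.ofReal_one]
    exact (ENNReal.ofReal_lt_ofReal_iff one_pos).mpr (by linarith))
  have herr : ∀ i ∈ J, nextSum^[n] (fun h => if T.guess h = i then 0 else
      ENNReal.ofReal (gram v (T.compressedOp K h) i i).re) [] ≤ ENNReal.ofReal ε := by
    intro i hi
    refine ENNReal.le_of_add_le_add_left (a := ENNReal.ofReal (1 - ε)) ENNReal.ofReal_ne_top ?_
    rw [← ENNReal.ofReal_add (by linarith [min_le_left 1 (c / (J.card + 1))]) hεpos.le,
      sub_add_cancel, ENNReal.ofReal_one, ← htotal i hi n]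
    gcongr
    exact (hn i).le
  have hsum : nextSum^[n] (errorAt v J T.guess (T.compressedOp K)) [] ≤
      ENNReal.ofReal (J.card * ε) := by
    have : errorAt v J T.guess (T.compressedOp K) = ∑ i ∈ J, fun h =>
        if T.guess h = i then 0 else ENNReal.ofReal (gram v (T.compressedOp K h) i i).re := by
      funext h
      rw [Finset.sum_apply, errorAt]
    rw [this, nextSum_iterate_sum, Finset.sum_apply]
    refine (Finset.sum_le_sum herr).trans ?_
    rw [Finset.sum_const, nsmul_eq_mul, ENNReal.ofReal_mul (by positivity), ENNReal.ofReal_natCast]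
  have hfin := (hbound n).trans hsum
  rw [ENNReal.ofReal_le_ofReal_iff (by positivity)] at hfin
  have h1 : J.card * ε ≤ J.card * (c / (J.card + 1)) := by
    gcongr
    exact min_le_right _ _
  have h2 : J.card * (c / (J.card + 1)) < c := by
    rw [mul_div_assoc', div_lt_iff₀ (by positivity)]
    nlinarith
  linarith

end Bridge

/-! ### Tiles: finite combinatorics of the supports -/

/-- Whether the coordinate `c` of a local state is nonzero. -/
def LocalState.supports : LocalState → Fin 3 → Bool
  | .k0, c => c == 0
  | .k1, c => c == 1
  | .k2, c => c == 2
  | .p1, c | .m1, c => c == 0 || c == 1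
  | .p2, c | .m2, c => c == 0 || c == 2

/-- The smallest coordinate that is nonzero. -/
def LocalState.base : LocalState → Fin 3
  | .k1 => 1
  | .k2 => 2
  | _ => 0

/-- Whether two local states are orthogonal. -/
def LocalState.orth : LocalState → LocalState → Bool
  | .p1, .m1 | .m1, .p1 | .p2, .m2 | .m2, .p2 => true
  | s, t => !((s.supports 0 && t.supports 0) || (s.supports 1 && t.supports 1) ||
      (s.supports 2 && t.supports 2))

/-- The ternary number with digits `a`, `b`, `c`, `d`. -/
def ternary (a b c d : Fin 3) : ℕ := 27 * a + 9 * b + 3 * c + d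

/-- The twisted states come in pairs whose common support consists of two computational product
states. Each of these is listed as `(n, m)` with the numbers `m < n` of the two states. -/
def twistedPairs : List (ℕ × ℕ) :=
  [(4, 3), (8, 6), (64, 63), (43, 42), (71, 69), (12, 9), (24, 18), (32, 29), (49, 46), (53, 47), (36, 27), (72, 54), (16, 7), (67, 58), (79, 61), (28, 1), (56, 2), (48, 21), (41, 14), (77, 23)]

/-- The least element of the tile (the common support of a pair of twisted states, or a single
computational product state) in which a computational product state lies. -/
def tile (n : ℕ) : ℕ := (twistedPairs.lookup n).getD n

/-- Identifies the support of each state with a tile, labelled by its least cell. This links the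
states to the arithmetic on cell numbers below. -/
theorem supports_eq_tile : ∀ (i : Fin 81) (a b c d : Fin 3),
    ((factors i 0).supports a && (factors i 1).supports b && (factors i 2).supports c &&
      (factors i 3).supports d) =
    (tile (ternary a b c d) == ternary (factors i 0).base (factors i 1).base (factors i 2).base
      (factors i 3).base) := by
  decide +kernel

theorem exists_orth : ∀ i j : Fin 81, i ≠ j → ∃ k, (factors i k).orth (factors j k) = true := by
  decide +kernel

/-- The contribution of the digit `u` at the position `k` to a ternary number. -/
def place (k : Fin 4) (u : Fin 3) : ℕ := 3 ^ (3 - k.val) * u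

/-- The pairs `{0, 2}` and `{1, 3}` of parties can split off their joint state `|22⟩` without
disturbing the basis. -/
def Strippable (a b : Fin 4) (u v : Fin 3) : Prop :=
  a.val % 2 = b.val % 2 ∧ u = 2 ∧ v = 2

instance (a b : Fin 4) (u v : Fin 3) : Decidable (Strippable a b u v) :=
  inferInstanceAs (Decidable (_ ∧ _))

/-- No support straddles the split-off `|22⟩` and its complement, so each state lies entirely on one
side. -/
theorem strippable_iff_of_supports : ∀ (a b : Fin 4), a ≠ b → ∀ (i : Fin 81) (u v : Fin 3),
    (factors i a).supports u = true → (factors i b).supports v = true →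
      (Strippable a b u v ↔ Strippable a b (factors i a).base (factors i b).base) := by
  decide +kernel

/-- Supplies the completions that kill the off-diagonal entries of the joint location; the next two
checks serve the lone parties, for off-diagonal and diagonal entries respectively. -/
theorem exists_tile_ne_of_pair_ne : ∀ a b c d : Fin 4, [a, b, c, d].Nodup → ∀ s t : Fin 3 × Fin 3,
    s ≠ t → ¬ Strippable a b s.1 s.2 → ¬ Strippable a b t.1 t.2 →
      ∃ w z, tile (place a s.1 + place b s.2 + place c w + place d z) ≠
        tile (place a t.1 + place b t.2 + place c w + place d z) := by
  decide +kernel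

theorem exists_tile_ne_of_ne : ∀ a b c d : Fin 4, [a, b, c, d].Nodup → ∀ w w' : Fin 3, w ≠ w' →
    ∃ u v z, ¬ Strippable a b u v ∧ tile (place a u + place b v + place c w + place d z) ≠
      tile (place a u + place b v + place c w' + place d z) := by
  decide +kernel

theorem exists_tile_eq_zero : ∀ a b c d : Fin 4, [a, b, c, d].Nodup → ∀ w : Fin 3,
    ∃ u v z, ¬ Strippable a b u v ∧ tile (place a u + place b v + place c w + place d z) =
      tile (place a u + place b v + place c 0 + place d z) := by
  decide +kernel

section Spread

variable {α : Type*}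

/-- The elements of `l'` that are related to some element of `l`. -/
def spread (r : α → α → Bool) (l' l : List α) : List α := l'.filter fun t => l.any fun s => r s t

theorem eq_of_mem_iterate_spread {β : Type*} {r : α → α → Bool} {l' : List α} {f : α → β}
    (hf : ∀ s ∈ l', ∀ t ∈ l', r s t = true → f s = f t) {s₀ : α} (hs₀ : s₀ ∈ l') (n : ℕ) :
    ∀ t ∈ (spread r l')^[n] [s₀], t ∈ l' ∧ f t = f s₀ := by
  induction n with
  | zero => simp [hs₀]
  | succ n ih =>
    intro t ht
    rw [Function.iterate_succ_apply', spread, List.mem_filter, List.any_eq_true] at ht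
    obtain ⟨ht, s, hs, hst⟩ := ht
    obtain ⟨hsl, hsf⟩ := ih s hs
    exact ⟨ht, (hf s hsl t ht hst).symm.trans hsf⟩

end Spread

/-- The pairs of local coordinates that cannot be split off. -/
def unstrippedPairs (a b : Fin 4) : List (Fin 3 × Fin 3) :=
  [(0, 0), (0, 1), (0, 2), (1, 0), (1, 1), (1, 2), (2, 0), (2, 1), (2, 2)].filter
    fun s => ¬ Strippable a b s.1 s.2

theorem mem_unstrippedPairs : ∀ (a b : Fin 4) (s : Fin 3 × Fin 3),
    s ∈ unstrippedPairs a b ↔ ¬ Strippable a b s.1 s.2 := by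
  decide +kernel

/-- Two pairs of local coordinates of the parties `a` and `b` can be completed by coordinates of the
other parties to elements of one tile. -/
def shareTile (a b c d : Fin 4) (s t : Fin 3 × Fin 3) : Bool :=
  decide (∃ w z, tile (place a s.1 + place b s.2 + place c w + place d z) =
    tile (place a t.1 + place b t.2 + place c w + place d z))

/-- `shareTile` is reflexive, so the iterates only grow; with at most nine vertices, eight steps
reach all of a connected graph. -/
theorem mem_iterate_spread_shareTile : ∀ a b c d : Fin 4, [a, b, c, d].Nodup →
    ∀ s ∈ unstrippedPairs a b, s ∈ (spread (shareTile a b c d) (unstrippedPairs a b))^[8] [(0, 0)] := by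
  decide +kernel

/-- The graph of `shareTile` is connected. -/
theorem eq_of_forall_tile_eq {β : Type*} {a b c d : Fin 4} (h : [a, b, c, d].Nodup)
    {f : Fin 3 × Fin 3 → β}
    (hf : ∀ s t w z, ¬ Strippable a b s.1 s.2 → ¬ Strippable a b t.1 t.2 →
      tile (place a s.1 + place b s.2 + place c w + place d z) =
        tile (place a t.1 + place b t.2 + place c w + place d z) → f s = f t)
    {s t : Fin 3 × Fin 3} (hs : ¬ Strippable a b s.1 s.2) (ht : ¬ Strippable a b t.1 t.2) :
    f s = f t := by
  have h0 : ∀ s, ¬ Strippable a b s.1 s.2 → f s = f (0, 0) := fun s hs => by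
    refine (eq_of_mem_iterate_spread (r := shareTile a b c d) (l' := unstrippedPairs a b) ?_ ?_ 8 s
      (mem_iterate_spread_shareTile a b c d h s ((mem_unstrippedPairs a b s).mpr hs))).2
    · intro s hs t ht hst
      obtain ⟨w, z, hwz⟩ := of_decide_eq_true hst
      exact hf s t w z ((mem_unstrippedPairs a b s).mp hs) ((mem_unstrippedPairs a b t).mp ht) hwz
    · exact (mem_unstrippedPairs a b _).mpr fun h => by simpa using h.2.1
  rw [h0 s hs, h0 t ht]

/-! ### Isolating one local factor of a tensor product -/

section Glue

variable {S P : Type} [DecidableEq P] {d : ℕ} {π : S → P}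

/-- The joint index that is `z` on the systems of party `p` and `r` on all others. -/
def glue {p : P} (z : LocalIndex d π p) (r : S → Fin d) (s : S) : Fin d :=
  if h : π s = p then z ⟨s, h⟩ else r s

theorem glue_of_eq {p : P} (z : LocalIndex d π p) (r : S → Fin d) {s : S} (h : π s = p) :
    glue z r s = z ⟨s, h⟩ := dif_pos h

theorem glue_of_ne {p : P} (z : LocalIndex d π p) (r : S → Fin d) {s : S} (h : π s ≠ p) :
    glue z r s = r s := dif_neg h

theorem restrict_glue {p : P} (z : LocalIndex d π p) (r : S → Fin d) :
    (fun s : {s // π s = p} => glue z r s) = z :=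
  funext fun s => glue_of_eq z r s.2

theorem restrict_glue_of_ne {p q : P} (h : q ≠ p) (z : LocalIndex d π p) (r : S → Fin d) :
    (fun s : {s // π s = q} => glue z r s) = fun s => r s.1 :=
  funext fun s => glue_of_ne z r (by rw [s.2]; exact h)

/-- The extension by zero of coefficients on a coordinate subspace. -/
def zeroExtend {κ : Type*} {K : κ → Prop} [DecidablePred K] (B : {z // K z} → {z // K z} → ℂ)
    (x y : κ) : ℂ :=
  if h : K x ∧ K y then B ⟨x, h.1⟩ ⟨y, h.2⟩ else 0

theorem zeroExtend_apply {κ : Type*} {K : κ → Prop} [DecidablePred K]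
    (B : {z // K z} → {z // K z} → ℂ) (x y : {z // K z}) : zeroExtend B x y = B x y :=
  dif_pos ⟨x.2, y.2⟩

theorem form_eq_form_zeroExtend {κ : Type*} [Fintype κ] {K : κ → Prop} [DecidablePred K]
    (B : {z // K z} → {z // K z} → ℂ) (u w : κ → ℂ) :
    form B (fun z => u z) (fun z => w z) = form (zeroExtend B) u w := by
  have hz : ∀ x y, ¬ (K x ∧ K y) → zeroExtend B x y = 0 := fun x y h => dif_neg h
  have hsub : ∀ f : κ → ℂ, (∀ x, ¬ K x → f x = 0) → ∑ x, f x = ∑ x : {z // K z}, f x := by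
    intro f hf
    rw [← Finset.sum_filter_of_ne (p := K) fun x _ hx => by_contra fun h => hx (hf x h)]
    exact Finset.sum_subtype _ (by simp) f
  rw [form, form, hsub]
  · refine Finset.sum_congr rfl fun x _ => ?_
    rw [hsub]
    · simp only [zeroExtend_apply]
    · intro y hy
      rw [hz _ _ fun h => hy h.2, mul_zero, zero_mul]
  · intro x hx
    exact Finset.sum_eq_zero fun y _ => by rw [hz _ _ fun h => hx h.1, mul_zero, zero_mul]

variable [Fintype P]

/-- The coefficients of the tensor product of local operators. -/
def tensorOp (A : ∀ p, LocalIndex d π p → LocalIndex d π p → ℂ) (x y : S → Fin d) : ℂ :=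
  ∏ p, A p (fun s => x s) fun s => y s

/-- Cells that agree away from `p` expose a single entry of the factor of `p`, multiplied by
diagonal entries of the other factors, which can be divided out if nonzero. -/
theorem tensorOp_glue (A : ∀ p, LocalIndex d π p → LocalIndex d π p → ℂ) {p : P}
    (y z : LocalIndex d π p) (r : S → Fin d) :
    tensorOp A (glue y r) (glue z r) =
      A p y z * ∏ q ∈ Finset.univ.erase p, A q (fun s => r s) fun s => r s := by
  rw [tensorOp, ← Finset.mul_prod_erase _ _ (Finset.mem_univ p), restrict_glue, restrict_glue]
  congr 1
  refine Finset.prod_congr rfl fun q hq => ?_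
  rw [restrict_glue_of_ne (Finset.ne_of_mem_erase hq),
    restrict_glue_of_ne (Finset.ne_of_mem_erase hq)]

theorem gram_localFactor [Fintype S] [DecidableEq S] {ι : Type} (w : ι → S → Fin d → ℂ)
    {K : ∀ p, LocalIndex d π p → Prop} [∀ p, DecidablePred (K p)]
    (B : ∀ p, {z // K p z} → {z // K p z} → ℂ) (i j : ι) :
    gram (fun i p (z : {z // K p z}) => localFactor π w i p z) B i j =
      form (tensorOp fun p => zeroExtend (B p)) (fun x => ∏ s, w i s (x s))
        fun x => ∏ s, w j s (x s) := by
  have h : ∀ x y : S → Fin d, star (∏ s, w i s (x s)) *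
      tensorOp (fun p => zeroExtend (B p)) x y * ∏ s, w j s (y s) =
      ∏ p, (star (localFactor π w i p fun s => x s) *
        zeroExtend (B p) (fun s => x s) (fun s => y s) * localFactor π w j p fun s => y s) := by
    intro x y
    rw [Finset.prod_mul_distrib, Finset.prod_mul_distrib, ← prod_localFactor (π := π),
      ← prod_localFactor (π := π), star_prod, tensorOp]
  rw [gram, form]
  simp only [h]
  simp only [fun x : S → Fin d => sum_prod_localIndex (π := π) fun p z =>
    star (localFactor π w i p fun s => x s) * zeroExtend (B p) (fun s => x s) z *
      localFactor π w j p z]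
  rw [sum_prod_localIndex (π := π) fun p y => ∑ z, star (localFactor π w i p y) *
    zeroExtend (B p) y z * localFactor π w j p z]
  exact Finset.prod_congr rfl fun p _ => form_eq_form_zeroExtend (B p) _ _

end Glue

/-! ### The basis: orthonormality, completeness and tiles -/

section Basis

theorem LocalState.vec_ne_zero_iff (ℓ : LocalState) (c : Fin 3) :
    ℓ.vec c ≠ 0 ↔ ℓ.supports c = true := by
  cases ℓ <;> fin_cases c <;> simp [LocalState.vec, LocalState.supports]

theorem LocalState.norm_vec_eq (ℓ : LocalState) {c c' : Fin 3} (hc : ℓ.supports c = true)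
    (hc' : ℓ.supports c' = true) : ‖ℓ.vec c‖ = ‖ℓ.vec c'‖ := by
  cases ℓ <;> fin_cases c <;> fin_cases c' <;>
    simp_all [LocalState.vec, LocalState.supports]

theorem ofReal_inv_sqrt_two_mul_self : (((√2)⁻¹ : ℝ) : ℂ) * (((√2)⁻¹ : ℝ) : ℂ) = 1 / 2 := by
  rw [← Complex.ofReal_mul, ← mul_inv, Real.mul_self_sqrt zero_le_two]
  norm_num

theorem LocalState.sum_star_vec_mul_vec_self (ℓ : LocalState) :
    ∑ c, star (ℓ.vec c) * ℓ.vec c = 1 := by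
  have h := ofReal_inv_sqrt_two_mul_self
  cases ℓ <;> simp only [LocalState.vec, Fin.sum_univ_three, Matrix.cons_val, RCLike.star_def,
    Complex.conj_ofReal, map_neg, map_zero, map_one, neg_mul_neg, h] <;> norm_num

theorem LocalState.sum_star_vec_mul_vec_of_orth {ℓ m : LocalState} (hlm : ℓ.orth m = true) :
    ∑ c, star (ℓ.vec c) * m.vec c = 0 := by
  cases ℓ <;> cases m <;>
    first
    | exact absurd hlm (by decide)
    | simp [LocalState.vec, Fin.sum_univ_three]

theorem inner_basisState (i j : Fin 81) :
    inner ℂ (basisState i) (basisState j) =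
      ∏ k, ∑ c, star ((factors i k).vec c) * (factors j k).vec c := by
  rw [Finset.prod_univ_sum, Fintype.piFinset_univ]
  simp only [PiLp.inner_apply, RCLike.inner_apply, basisState, map_prod, Finset.prod_mul_distrib,
    RCLike.star_def]
  exact Finset.sum_congr rfl fun x _ => mul_comm _ _

theorem orthonormal_basisState : Orthonormal ℂ basisState := by
  rw [orthonormal_iff_ite]
  intro i j
  rw [inner_basisState]
  split_ifs with hij
  · subst hij
    simp only [LocalState.sum_star_vec_mul_vec_self, Finset.prod_const_one]
  · obtain ⟨k, hk⟩ := exists_orth i j hij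
    exact Finset.prod_eq_zero (Finset.mem_univ k) (LocalState.sum_star_vec_mul_vec_of_orth hk)

theorem span_basisState : Submodule.span ℂ (Set.range basisState) = ⊤ :=
  orthonormal_basisState.linearIndependent.span_eq_top_of_card_eq_finrank (by simp)

/-- The coefficient matrix is square, since `3 ^ 4 = 81`, so orthonormal rows imply orthonormal
columns. -/
theorem sum_basisState_mul_star (x y : Fin 4 → Fin 3) :
    ∑ i, basisState i x * star (basisState i y) = if x = y then 1 else 0 := by
  let U : Matrix (Fin 81) (Fin 4 → Fin 3) ℂ := Matrix.of fun i x => star (basisState i x)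
  have h : U * U.conjTranspose = 1 := by
    ext i j
    rw [Matrix.one_apply, ← orthonormal_iff_ite.mp orthonormal_basisState i j, Matrix.mul_apply]
    simp only [PiLp.inner_apply, RCLike.inner_apply, Matrix.conjTranspose_apply, U, Matrix.of_apply,
      star_star]
    exact Finset.sum_congr rfl fun x _ => mul_comm _ _
  have h' := (Matrix.mul_eq_one_comm_of_card_eq _ _ _ (by simp)).mp h
  have := congrFun (congrFun h' x) y
  rw [Matrix.mul_apply, Matrix.one_apply] at this
  simpa [U] using this

/-- The matrix elements of an operator with respect to the computational basis, in terms of those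
with respect to the basis `basisState`. -/
theorem eq_sum_basisState_mul_form (E : (Fin 4 → Fin 3) → (Fin 4 → Fin 3) → ℂ)
    (x y : Fin 4 → Fin 3) :
    E x y = ∑ i, ∑ j, basisState i x * form E (basisState i) (basisState j) *
      star (basisState j y) := by
  have h1 : ∀ i j, basisState i x * form E (basisState i) (basisState j) * star (basisState j y) =
      ∑ x', ∑ y', (basisState i x * star (basisState i x')) * E x' y' *
        (basisState j y' * star (basisState j y)) := by
    intro i j
    simp only [form, Finset.mul_sum, Finset.sum_mul]
    exact Finset.sum_congr rfl fun _ _ => Finset.sum_congr rfl fun _ _ => by ring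
  have h2 : ∀ x' y', ∑ i, ∑ j, (basisState i x * star (basisState i x')) * E x' y' *
      (basisState j y' * star (basisState j y)) =
      (if x = x' then 1 else 0) * E x' y' * (if y' = y then 1 else 0) := by
    intro x' y'
    simp only [← sum_basisState_mul_star, Finset.sum_mul, Finset.mul_sum]
    exact Finset.sum_comm
  simp only [h1]
  rw [Finset.sum_congr rfl fun i _ => Finset.sum_comm, Finset.sum_comm,
    Finset.sum_congr rfl fun x' _ => Finset.sum_congr rfl fun i _ => Finset.sum_comm,
    Finset.sum_congr rfl fun x' _ => Finset.sum_comm]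
  simp only [h2]
  simp

theorem basisState_ne_zero_iff (i : Fin 81) (x : Fin 4 → Fin 3) :
    basisState i x ≠ 0 ↔ ∀ k, (factors i k).supports (x k) = true := by
  change ∏ k, (factors i k).vec (x k) ≠ 0 ↔ _
  simp only [Finset.prod_ne_zero_iff, Finset.mem_univ, true_imp_iff, LocalState.vec_ne_zero_iff]

/-- The number of an element of the computational product basis. -/
def cellNumber (x : Fin 4 → Fin 3) : ℕ := ternary (x 0) (x 1) (x 2) (x 3)

theorem cellNumber_eq_sum (x : Fin 4 → Fin 3) : cellNumber x = ∑ k, place k (x k) := by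
  rw [Fin.sum_univ_four]
  simp [cellNumber, ternary, place]

theorem cellNumber_eq {a b c d : Fin 4} (h : [a, b, c, d].Nodup) (x : Fin 4 → Fin 3) :
    cellNumber x = place a (x a) + place b (x b) + place c (x c) + place d (x d) := by
  have h1 : ∀ a b c d : Fin 4, [a, b, c, d].Nodup → Finset.univ = [a, b, c, d].toFinset := by
    decide +kernel
  rw [cellNumber_eq_sum, h1 a b c d h, List.sum_toFinset _ h]
  simp [add_assoc]

theorem basisState_ne_zero_iff_tile (i : Fin 81) (x : Fin 4 → Fin 3) :
    basisState i x ≠ 0 ↔ tile (cellNumber x) = cellNumber fun k => (factors i k).base := by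
  rw [basisState_ne_zero_iff, cellNumber, cellNumber, ← beq_iff_eq, ← supports_eq_tile]
  simp [Fin.forall_fin_succ, and_assoc]

/-- Both coordinates of a twisted state have the same modulus. This is why diagonal entries of an
orthogonality-preserving operator agree on a tile. -/
theorem norm_basisState_eq_of_tile_eq (i : Fin 81) {x y : Fin 4 → Fin 3}
    (h : tile (cellNumber x) = tile (cellNumber y)) : ‖basisState i x‖ = ‖basisState i y‖ := by
  by_cases hx : basisState i x = 0
  · have hy : basisState i y = 0 := by
      by_contra hy
      exact (basisState_ne_zero_iff_tile i x).mpr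
        (h.trans ((basisState_ne_zero_iff_tile i y).mp hy)) hx
    rw [hx, hy]
  · have hy := (basisState_ne_zero_iff_tile i y).mpr
      (h.symm.trans ((basisState_ne_zero_iff_tile i x).mp hx))
    have hx := (basisState_ne_zero_iff i x).mp hx
    have hy := (basisState_ne_zero_iff i y).mp hy
    change ‖∏ k, (factors i k).vec (x k)‖ = ‖∏ k, (factors i k).vec (y k)‖
    rw [norm_prod, norm_prod]
    exact Finset.prod_congr rfl fun k _ => LocalState.norm_vec_eq _ (hx k) (hy k)

end Basis

/-! ### Local irreducibility for three locations -/

section Tripartition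

variable {P : Type}

/-- The local coordinates that remain when the joint state `|22⟩` of the parties `a` and `b`, who are
in one location, has been split off if possible. -/
def Unstripped (π : Fin 4 → P) (a b : Fin 4) (p : P) (z : LocalIndex 3 π p) : Prop :=
  ∀ (ha : π a = p) (hb : π b = p), ¬ Strippable a b (z ⟨a, ha⟩) (z ⟨b, hb⟩)

theorem unstripped_restrict {π : Fin 4 → P} {a b : Fin 4} {x : Fin 4 → Fin 3}
    (hx : ¬ Strippable a b (x a) (x b)) (p : P) :
    Unstripped π a b p fun s => x s := fun _ _ => hx

variable [DecidableEq P]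

instance (π : Fin 4 → P) (a b : Fin 4) (p : P) : DecidablePred (Unstripped π a b p) :=
  fun _ => inferInstanceAs (Decidable (∀ _ : π a = p, ∀ _ : π b = p, ¬ _))

/-- The states of the basis that are orthogonal to what has been split off. -/
def unstrippedStates (a b : Fin 4) : Finset (Fin 81) :=
  {i | ¬ Strippable a b (factors i a).base (factors i b).base}

theorem nontrivial_unstrippedStates (a b : Fin 4) : (unstrippedStates a b).Nontrivial := by
  -- These are `|0⟩|0⟩|1⟩|0±1⟩`; no coordinate `2` occurs in them, so they are never split off.
  refine ⟨0, ?_, 1, ?_, by decide⟩ <;> revert a b <;>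
    simp only [unstrippedStates, Finset.coe_filter, Finset.mem_univ, true_and] <;>
    decide +kernel

theorem mem_unstrippedStates {a b : Fin 4} (hab : a ≠ b) {i : Fin 81} {x : Fin 4 → Fin 3}
    (hx : ¬ Strippable a b (x a) (x b)) (hi : basisState i x ≠ 0) : i ∈ unstrippedStates a b := by
  have hs := (basisState_ne_zero_iff i x).mp hi
  rw [unstrippedStates, Finset.mem_filter]
  exact ⟨Finset.mem_univ _, fun h =>
    hx ((strippable_iff_of_supports a b hab i _ _ (hs a) (hs b)).mpr h)⟩

variable {π : Fin 4 → P} {a b : Fin 4}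

theorem unstripped_of_localFactor_ne_zero (hab : a ≠ b) {i : Fin 81}
    (hi : i ∈ unstrippedStates a b) (p : P) (z : LocalIndex 3 π p)
    (hz : localFactor π (fun i k => (factors i k).vec) i p z ≠ 0) : Unstripped π a b p z := by
  intro ha hb h
  rw [localFactor, Finset.prod_ne_zero_iff] at hz
  have hz' : ∀ k (hk : π k = p), (factors i k).supports (z ⟨k, hk⟩) = true := fun k hk =>
    (LocalState.vec_ne_zero_iff _ _).mp (hz ⟨k, hk⟩ (Finset.mem_univ _))
  rw [unstrippedStates, Finset.mem_filter] at hi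
  exact hi.2 ((strippable_iff_of_supports a b hab i _ _ (hz' a ha) (hz' b hb)).mp h)

variable [Fintype P]

theorem locallyIrreducible_basisState {c d : Fin 4} (h : [a, b, c, d].Nodup) (hab : π a = π b)
    (hac : π a ≠ π c) (had : π a ≠ π d) (hcd : π c ≠ π d) :
    LocallyIrreducible (fun i p (z : {z // Unstripped π a b p z}) =>
      localFactor π (fun i k => (factors i k).vec) i p z) (unstrippedStates a b) := by
  intro B hdiag hB
  have hne : a ≠ b := by
    rintro rfl
    simp at h
  set E := tensorOp fun p => zeroExtend (B p) with hE
  have hform : ∀ i ∈ unstrippedStates a b, ∀ j ∈ unstrippedStates a b, i ≠ j →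
      form E (basisState i) (basisState j) = 0 := fun i hi j hj hij => by
    rw [← hB i hi j hj hij, gram_localFactor]
    rfl
  -- Only states in `unstrippedStates a b` have nonzero coordinates at unstripped cells, so
  -- orthogonality within that family removes every off-diagonal term.
  have hexp : ∀ x y, ¬ Strippable a b (x a) (x b) → ¬ Strippable a b (y a) (y b) →
      E x y = ∑ i, form E (basisState i) (basisState i) *
        (basisState i x * star (basisState i y)) := by
    intro x y hx hy
    rw [eq_sum_basisState_mul_form E x y]
    refine Finset.sum_congr rfl fun i _ => ?_
    rw [Finset.sum_eq_single i]
    · ring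
    · intro j _ hji
      by_cases hi : basisState i x = 0
      · rw [hi, zero_mul, zero_mul]
      by_cases hj : basisState j y = 0
      · rw [hj, star_zero, mul_zero]
      rw [hform i (mem_unstrippedStates hne hx hi) j (mem_unstrippedStates hne hy hj) hji.symm,
        mul_zero, zero_mul]
    · simp
  have hrest : ∀ p (r : Fin 4 → Fin 3), ¬ Strippable a b (r a) (r b) →
      ∏ q ∈ Finset.univ.erase p, zeroExtend (B q) (fun s => r s) (fun s => r s) ≠ 0 := by
    intro p r hr
    refine Finset.prod_ne_zero_iff.mpr fun q _ => ?_
    have := zeroExtend_apply (B q) ⟨_, unstripped_restrict hr q⟩ ⟨_, unstripped_restrict hr q⟩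
    rw [this]
    exact hdiag q _
  -- No state is nonzero at cells of two different tiles, so the expansion vanishes termwise.
  have hoff : ∀ p (x y : {z // Unstripped π a b p z}) (r : Fin 4 → Fin 3),
      ¬ Strippable a b (r a) (r b) →
      ¬ Strippable a b (glue x.1 r a) (glue x.1 r b) →
      ¬ Strippable a b (glue y.1 r a) (glue y.1 r b) →
      tile (cellNumber (glue x.1 r)) ≠ tile (cellNumber (glue y.1 r)) → B p x y = 0 := by
    intro p x y r hr hx hy hxy
    have h0 : E (glue x.1 r) (glue y.1 r) = 0 := by
      rw [hexp _ _ hx hy]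
      refine Finset.sum_eq_zero fun i _ => ?_
      by_cases hi : basisState i (glue x.1 r) = 0
      · rw [hi, zero_mul, mul_zero]
      by_cases hj : basisState i (glue y.1 r) = 0
      · rw [hj, star_zero, mul_zero, mul_zero]
      exact absurd (((basisState_ne_zero_iff_tile i _).mp hi).trans
        ((basisState_ne_zero_iff_tile i _).mp hj).symm) hxy
    rw [hE, tensorOp_glue, zeroExtend_apply] at h0
    exact (mul_eq_zero.mp h0).resolve_right (hrest p r hr)
  have hon : ∀ p (x y : {z // Unstripped π a b p z}) (r : Fin 4 → Fin 3),
      ¬ Strippable a b (r a) (r b) →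
      ¬ Strippable a b (glue x.1 r a) (glue x.1 r b) →
      ¬ Strippable a b (glue y.1 r a) (glue y.1 r b) →
      tile (cellNumber (glue x.1 r)) = tile (cellNumber (glue y.1 r)) → B p x x = B p y y := by
    intro p x y r hr hx hy hxy
    have h0 : E (glue x.1 r) (glue x.1 r) = E (glue y.1 r) (glue y.1 r) := by
      rw [hexp _ _ hx hx, hexp _ _ hy hy]
      refine Finset.sum_congr rfl fun i _ => ?_
      have hsq : ∀ z : ℂ, z * star z = (‖z‖ : ℂ) ^ 2 := Complex.mul_conj'
      rw [hsq, hsq, norm_basisState_eq_of_tile_eq i hxy]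
    rw [hE, tensorOp_glue, tensorOp_glue, zeroExtend_apply, zeroExtend_apply] at h0
    exact mul_right_cancel₀ (hrest p r hr) h0
  have hscalar : ∀ p, (∀ x y, x ≠ y → B p x y = 0) → (∀ x y, B p x x = B p y y) →
      ∃ c : ℂ, B p = fun x y => if x = y then c else 0 := by
    intro p h1 h2
    rcases isEmpty_or_nonempty {z // Unstripped π a b p z} with he | ⟨⟨x₀⟩⟩
    · exact ⟨0, funext fun x => (he.false x).elim⟩
    · refine ⟨B p x₀ x₀, funext fun x => funext fun y => ?_⟩
      split_ifs with hxy
      · rw [← hxy, h2 x x₀]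
      · exact h1 x y hxy
  have hmem : ∀ k, k = a ∨ k = b ∨ k = c ∨ k = d := by
    revert h
    clear * -
    revert a b c d
    decide +kernel
  -- A party standing alone. It is stated for arbitrary `c` and `d` so that it can be reused with
  -- the two exchanged.
  have hsingle : ∀ c d : Fin 4, [a, b, c, d].Nodup → π a ≠ π c → π c ≠ π d →
      (∀ k, k = a ∨ k = b ∨ k = c ∨ k = d) →
      ∃ e : ℂ, B (π c) = fun x y => if x = y then e else 0 := by
    intro c d h hac hcd hmem
    have honly : ∀ k, π k = π c → k = c := by
      intro k hk
      rcases hmem k with rfl | rfl | rfl | rfl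
      · exact absurd hk hac
      · exact absurd (hab.trans hk) hac
      · rfl
      · exact absurd hk.symm hcd
    have hbc : π b ≠ π c := hab ▸ hac
    let r : Fin 3 → Fin 3 → Fin 3 → Fin 4 → Fin 3 := fun u v z k =>
      if k = a then u else if k = b then v else z
    have hra : ∀ u v z, r u v z a = u := fun u v z => if_pos rfl
    have hrb : ∀ u v z, r u v z b = v := fun u v z => by simp [r, hne.symm]
    have hrd : ∀ u v z, r u v z d = z := fun u v z => by
      have : d ≠ a ∧ d ≠ b := by
        simp only [List.nodup_cons, List.mem_cons, not_or] at h
        exact ⟨fun e => h.1.2.2.1 e.symm, fun e => h.2.1.2.1 e.symm⟩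
      simp [r, this]
    have hcell : ∀ (x : LocalIndex 3 π (π c)) u v z, cellNumber (glue x (r u v z)) =
        place a u + place b v + place c (x ⟨c, rfl⟩) + place d z := by
      intro x u v z
      rw [cellNumber_eq h, glue_of_ne x _ hac, glue_of_ne x _ hbc, glue_of_eq x _ rfl,
        glue_of_ne x _ hcd.symm, hra, hrb, hrd]
    have hglue : ∀ (x : LocalIndex 3 π (π c)) u v z, ¬ Strippable a b u v →
        ¬ Strippable a b (glue x (r u v z) a) (glue x (r u v z) b) := by
      intro x u v z huv
      rwa [glue_of_ne x _ hac, glue_of_ne x _ hbc, hra, hrb]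
    have hr : ∀ u v z, ¬ Strippable a b u v → ¬ Strippable a b (r u v z a) (r u v z b) := by
      intro u v z huv
      rwa [hra, hrb]
    refine hscalar (π c) (fun x y hxy => ?_) ?_
    · have hw : x.1 ⟨c, rfl⟩ ≠ y.1 ⟨c, rfl⟩ := by
        refine fun e => hxy (Subtype.ext (funext fun ⟨k, hk⟩ => ?_))
        obtain rfl := honly k hk
        exact e
      obtain ⟨u, v, z, huv, ht⟩ := exists_tile_ne_of_ne a b c d h _ _ hw
      refine hoff _ x y (r u v z) (hr u v z huv) (hglue _ u v z huv) (hglue _ u v z huv) ?_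
      rwa [hcell, hcell]
    · have h0 : ∀ x y : {z // Unstripped π a b (π c) z}, y.1 ⟨c, rfl⟩ = 0 →
          B (π c) x x = B (π c) y y := by
        intro x y hy
        obtain ⟨u, v, z, huv, ht⟩ := exists_tile_eq_zero a b c d h (x.1 ⟨c, rfl⟩)
        refine hon _ x y (r u v z) (hr u v z huv) (hglue _ u v z huv) (hglue _ u v z huv) ?_
        rwa [hcell, hcell, hy]
      let o : {z // Unstripped π a b (π c) z} := ⟨fun _ => 0, fun ha => absurd ha hac⟩
      intro x y
      rw [h0 x o rfl, h0 y o rfl]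
  intro p
  by_cases hpc : p = π c
  · rw [hpc]
    exact hsingle c d h hac hcd hmem
  by_cases hpd : p = π d
  · rw [hpd]
    refine hsingle d c ?_ had hcd.symm fun k => ?_
    · simp only [List.nodup_cons, List.mem_cons, List.not_mem_nil, not_or] at h ⊢
      tauto
    · have := hmem k
      tauto
  by_cases hpa : π a = p
  · have hpb : π b = p := hab ▸ hpa
    have honly : ∀ k, π k = p → k = a ∨ k = b := by
      intro k hk
      rcases hmem k with rfl | rfl | rfl | rfl
      · exact Or.inl rfl
      · exact Or.inr rfl
      · exact absurd hk.symm hpc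
      · exact absurd hk.symm hpd
    have hdc : d ≠ c := fun e => hcd (e ▸ rfl)
    have hca : a ≠ c := fun e => hac (e ▸ rfl)
    have hda : a ≠ d := fun e => had (e ▸ rfl)
    -- The default `0` at `a` and `b` keeps the reference cell unstripped; gluing overwrites it.
    let r : Fin 3 → Fin 3 → Fin 4 → Fin 3 := fun w z k =>
      if k = c then w else if k = d then z else 0
    have hrc : ∀ w z, r w z c = w := fun w z => if_pos rfl
    have hrd : ∀ w z, r w z d = z := fun w z => by simp [r, hdc]
    have hr : ∀ w z, ¬ Strippable a b (r w z a) (r w z b) := fun w z hs => by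
      have := hs.2.1
      simp [r, hca, hda] at this
    have hcell : ∀ (x : LocalIndex 3 π p) w z, cellNumber (glue x (r w z)) =
        place a (x ⟨a, hpa⟩) + place b (x ⟨b, hpb⟩) + place c w + place d z := by
      intro x w z
      rw [cellNumber_eq h, glue_of_eq x _ hpa, glue_of_eq x _ hpb,
        glue_of_ne x _ fun e => hpc e.symm, glue_of_ne x _ fun e => hpd e.symm, hrc, hrd]
    have hglue : ∀ (x : {z // Unstripped π a b p z}) w z,
        ¬ Strippable a b (glue x.1 (r w z) a) (glue x.1 (r w z) b) := by
      intro x w z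
      rw [glue_of_eq x.1 _ hpa, glue_of_eq x.1 _ hpb]
      exact x.2 hpa hpb
    refine hscalar p (fun x y hxy => ?_) ?_
    · have hst : ((x.1 ⟨a, hpa⟩, x.1 ⟨b, hpb⟩) : Fin 3 × Fin 3) ≠ (y.1 ⟨a, hpa⟩, y.1 ⟨b, hpb⟩) := by
        refine fun e => hxy (Subtype.ext (funext fun ⟨k, hk⟩ => ?_))
        rcases honly k hk with rfl | rfl
        · exact congrArg Prod.fst e
        · exact congrArg Prod.snd e
      obtain ⟨w, z, ht⟩ := exists_tile_ne_of_pair_ne a b c d h _ _ hst (x.2 hpa hpb) (y.2 hpa hpb)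
      refine hoff p x y (r w z) (hr w z) (hglue x w z) (hglue y w z) ?_
      rwa [hcell, hcell]
    · let m : Fin 3 × Fin 3 → LocalIndex 3 π p := fun s k => if k.1 = a then s.1 else s.2
      have hma : ∀ s, m s ⟨a, hpa⟩ = s.1 := fun s => if_pos rfl
      have hmb : ∀ s, m s ⟨b, hpb⟩ = s.2 := fun s => if_neg hne.symm
      have hm : ∀ s : Fin 3 × Fin 3, ¬ Strippable a b s.1 s.2 → Unstripped π a b p (m s) := by
        intro s hs _ _
        rwa [hma, hmb]
      have hx : ∀ x : {z // Unstripped π a b p z},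
          zeroExtend (B p) (m (x.1 ⟨a, hpa⟩, x.1 ⟨b, hpb⟩)) (m (x.1 ⟨a, hpa⟩, x.1 ⟨b, hpb⟩)) =
            B p x x := by
        intro x
        have : m (x.1 ⟨a, hpa⟩, x.1 ⟨b, hpb⟩) = x.1 := by
          funext ⟨k, hk⟩
          rcases honly k hk with rfl | rfl
          · exact hma _
          · exact hmb _
        rw [this, zeroExtend_apply]
      intro x y
      rw [← hx x, ← hx y]
      refine eq_of_forall_tile_eq h (f := fun s => zeroExtend (B p) (m s) (m s)) ?_ (x.2 hpa hpb)
        (y.2 hpa hpb)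
      intro s t w z hs ht hst
      have h1 := zeroExtend_apply (B p) ⟨m s, hm s hs⟩ ⟨m s, hm s hs⟩
      have h2 := zeroExtend_apply (B p) ⟨m t, hm t ht⟩ ⟨m t, hm t ht⟩
      rw [h1, h2]
      refine hon p ⟨m s, hm s hs⟩ ⟨m t, hm t ht⟩ (r w z) (hr w z) (hglue ⟨m s, hm s hs⟩ w z)
        (hglue ⟨m t, hm t ht⟩ w z) ?_
      rw [hcell, hcell]
      simpa only [hma, hmb] using hst
  -- This party holds no system, so its local space is one-dimensional.
  · have : Subsingleton {z // Unstripped π a b p z} := by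
      refine ⟨fun x y => Subtype.ext (funext fun ⟨k, hk⟩ => ?_)⟩
      rcases hmem k with rfl | rfl | rfl | rfl
      · exact absurd hk hpa
      · exact absurd (hab.trans hk) hpa
      · exact absurd hk.symm hpc
      · exact absurd hk.symm hpd
    exact hscalar p (fun x y hxy => absurd (Subsingleton.elim x y) hxy)
      fun x y => by rw [Subsingleton.elim x y]

theorem not_LOCCDistinguishable_basisState {c d : Fin 4} (h : [a, b, c, d].Nodup)
    (hab : π a = π b) (hac : π a ≠ π c) (had : π a ≠ π d) (hcd : π c ≠ π d) :
    ¬ LOCCDistinguishable π basisState := by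
  have hne : a ≠ b := by
    rintro rfl
    simp at h
  exact (locallyIrreducible_basisState h hab hac had hcd).not_LOCCDistinguishable
    (fun i => orthonormal_basisState.1 i) (nontrivial_unstrippedStates a b)
    fun i hi => unstripped_of_localFactor_ne_zero hne hi

end Tripartition

theorem exists_nodup_of_ne : ∀ a b : Fin 4, a ≠ b → ∃ c d, [a, b, c, d].Nodup := by
  decide

end

theorem proposition3 :
    (Orthonormal ℂ basisState ∧ Submodule.span ℂ (Set.range basisState) = ⊤) ∧
    (∀ (a b : Fin 4) (hab : a ≠ b), ¬ LOCCDistinguishable (bringTogether hab) basisState) ∧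
    (∀ (P : Type) [Fintype P] [DecidableEq P] (π : Fin 4 → P),
      Fintype.card P = 3 → Function.Surjective π → ¬ LOCCDistinguishable π basisState) := by
  refine ⟨⟨orthonormal_basisState, span_basisState⟩, fun a b hab => ?_, ?_⟩
  · obtain ⟨c, d, h⟩ := exists_nodup_of_ne a b hab
    have h' := h
    simp only [List.nodup_cons, List.mem_cons, List.not_mem_nil, not_or, or_false] at h'
    obtain ⟨⟨-, hac, had⟩, ⟨hbc, hbd⟩, hcd, -⟩ := h'
    refine not_LOCCDistinguishable_basisState h ?_ ?_ ?_ ?_ <;>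
      simp [bringTogether, hab, hac, had, hcd, Ne.symm hbc, Ne.symm hbd]
  · intro P _ _ π hP hπ
    obtain ⟨a, b, hab, hπab⟩ := Fintype.exists_ne_map_eq_of_card_lt π (by simp [hP])
    obtain ⟨c, d, h⟩ := exists_nodup_of_ne a b hab
    have h1 : ∀ a b c d : Fin 4, [a, b, c, d].Nodup → ∀ k, k = b ∨ k ∈ ({a, c, d} : Finset _) := by
      decide +kernel
    have himage : Finset.image π {a, c, d} = Finset.univ := by
      refine Finset.eq_univ_of_forall fun p => ?_
      obtain ⟨k, rfl⟩ := hπ p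
      rcases h1 a b c d h k with rfl | hk
      · exact Finset.mem_image.mpr ⟨a, by simp, hπab⟩
      · exact Finset.mem_image_of_mem π hk
    have h' := h
    simp only [List.nodup_cons, List.mem_cons, List.not_mem_nil, not_or, or_false] at h'
    obtain ⟨⟨-, hac, had⟩, -, hcd, -⟩ := h'
    -- Since `a` and `b` share a location, `a`, `c`, `d` already reach all three locations, and
    -- hence occupy distinct ones.
    have hinj : Set.InjOn π ({a, c, d} : Finset (Fin 4)) := by
      rw [← Finset.card_image_iff, himage, Finset.card_univ, hP,
        Finset.card_eq_three.mpr ⟨a, c, d, hac, had, hcd, rfl⟩]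
    exact not_LOCCDistinguishable_basisState h hπab
      (fun e => hac (hinj (by simp) (by simp) e)) (fun e => had (hinj (by simp) (by simp) e))
      fun e => hcd (hinj (by simp) (by simp) e)
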